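/- Call an $n$-node oriented 4-regular tree a finite tree on $n$ nodes in which every node has degree $4$ or $1$, whose edges are consistently labeled with directions: at each of its ends every edge carries a label in $\{U,D,L,R\}$, the labels of the edges at a node are pairwise distinct, and an edge labeled $R$ (resp. $U$) at one end is labeled $L$ (resp. $D$) at the other. (Such trees exist exactly for $n\ge 2$, $n\equiv 2 \pmod 3$.) A randomized $t$-round algorithm is a (measurable) map from the radius-$t$ neighborhoods $B_t(v)$ to colors, where the nodes are labeled with unique identifiers, private infinite sequences of independent unbiased random bits, and the directions of their incident edges; the algorithm may depend on $n$. A weak $2$-coloring is a map $\varphi : V\to\{1,2\}$ such that every node has a neighbor of the other color. A $t$-round algorithm solves weak $2$-coloring on $n$-node oriented 4-regular trees with global success probability at least $\frac12$ if on every such tree, and for every assignment of the identifiers $1,\dots,n$ to its nodes, its output is a weak $2$-coloring of the whole tree with probability at least $\frac12$. Let $\log^* n$ be the number of times $\log_2$ has to be applied to $n$ until the result is at most $1$. Theorem. Solving weak $2$-coloring on oriented 4-regular trees with global success probability at least $\frac12$ requires $\Omega(\log^* n)$ rounds: there are $c>0$ and $n_0$ such that for all $n\ge n_0$ with $n\equiv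 2\pmod 3$, every $t$-round randomized algorithm that solves weak $2$-coloring on $n$-node oriented 4-regular trees with global success probability at least $\frac12$ has $t\ge c\log^* n$. Concretely, there is $n_0$ such that for all $n\ge n_0$ with $n\equiv 2\pmod 3$ and all integers $0\le t\le \frac12\log^* n-4$, no $t$-round randomized algorithm solves weak $2$-coloring on $n$-node oriented 4-regular trees with global success probability at least $\frac12$. -/

import Mathlib

open MeasureTheory
open scoped ENNReal

/-! ### The iterated logarithm -/

/-- `logStar n` is the least number of times the base-2 logarithm has to be applied to `n`
until the result is at most `1`. -/
noncomputable def logStar (n : ℕ) : ℕ :=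
  sInf {k : ℕ | (Real.logb 2)^[k] (n : ℝ) ≤ 1}

/-! ### Consistently oriented 4-regular trees -/

/-- The four directions up, down, left, right. -/
inductive Dir where
  | U | D | L | R
  deriving DecidableEq

instance : Fintype Dir := ⟨{.U, .D, .L, .R}, fun x => by cases x <;> decide⟩

/-- The opposite direction. -/
def Dir.opp : Dir → Dir
  | .U => .D
  | .D => .U
  | .L => .R
  | .R => .L

/-- A consistently oriented 4-regular tree on the vertex set `V`: a tree in which every node has
degree 4 or is a leaf, where every edge carries at each of its ends one direction label, the
labels at a node are pairwise distinct, and the labels at the two ends of an edge are opposite.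
`nbr v x` is the other end of the edge with label `x` at `v`, if there is such an edge. -/
structure OrientedTree (V : Type) where
  graph : SimpleGraph V
  isTree : graph.IsTree
  regular : ∀ v, (graph.neighborSet v).ncard = 4 ∨ (graph.neighborSet v).ncard = 1
  nbr : V → Dir → Option V
  adj_iff : ∀ u v, graph.Adj u v ↔ ∃ x, nbr u x = some v
  label_unique : ∀ u v x y, nbr u x = some v → nbr u y = some v → x = y
  nbr_opp : ∀ u v x, nbr u x = some v → nbr v x.opp = some u

/-- The node reached from `v` by following the directions in the list, if it exists. -/
def OrientedTree.follow {V : Type} (G : OrientedTree V) : V → List Dir → Option V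
  | v, [] => some v
  | v, x :: w => (G.nbr v x).bind fun u => G.follow u w

/-! ### Weak colorings -/

/-- A weak `c`-coloring: every node has a neighbor with a different color. -/
def IsWeakColoring {V : Type} (G : SimpleGraph V) {c : ℕ} (φ : V → Fin c) : Prop :=
  ∀ v, ∃ u, G.Adj v u ∧ φ u ≠ φ v

/-! ### Randomized algorithms in the LOCAL model -/

/-- Sequences of directions of length at most `t`; they address the nodes of a radius-`t`
neighborhood relative to its center. -/
abbrev Address (t : ℕ) : Type := {w : List Dir // w.length ≤ t}

/-- The non-random part of a radius-`t` neighborhood: at each address, whether there is a node,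
and if so, its identifier and the directions of its incident edges (hence its degree). -/
abbrev Topology (n t : ℕ) : Type := Address t → Option (Fin n × (Dir → Bool))

/-- The random part of a radius-`t` neighborhood: the random bit sequence of the node at each
address (by convention all `false` where there is no node). -/
abbrev BitView (t : ℕ) : Type := Address t → ℕ → Bool

/-- A randomized `t`-round algorithm for `n`-node trees that outputs colors in `Fin c`: a map from
radius-`t` neighborhoods, labeled with orientation, identifiers and random bits, to colors,
measurable in the random bits. -/
structure LocalAlgorithm (n t c : ℕ) where
  out : Topology n t → BitView t → Fin c
  measurable_out : ∀ T, Measurable (out T)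

namespace OrientedTree

variable {V : Type} (G : OrientedTree V) {n : ℕ}

/-- The non-random part of the radius-`t` neighborhood of `v`. -/
def topologyAt (ids : V ≃ Fin n) (t : ℕ) (v : V) : Topology n t :=
  fun w => (G.follow v w.1).map fun u => (ids u, fun x => (G.nbr u x).isSome)

/-- The random part of the radius-`t` neighborhood of `v`. -/
def bitsAt (t : ℕ) (ω : V → ℕ → Bool) (v : V) : BitView t :=
  fun w => ((G.follow v w.1).map ω).getD fun _ => false

end OrientedTree

/-- The output of the algorithm at every node. -/
def LocalAlgorithm.run {V : Type} {n t c : ℕ} (A : LocalAlgorithm n t c) (G : OrientedTree V)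
    (ids : V ≃ Fin n) (ω : V → ℕ → Bool) : V → Fin c :=
  fun v => A.out (G.topologyAt ids t v) (G.bitsAt t ω v)

/-- The law of one private sequence of independent unbiased random bits. -/
noncomputable def bitSequenceLaw : Measure (ℕ → Bool) :=
  Measure.infinitePi fun _ => (PMF.uniformOfFintype Bool).toMeasure

/-- The joint law of the random bits: the nodes have independent private sequences. -/
noncomputable def bitsLaw (V : Type) [Fintype V] : Measure (V → ℕ → Bool) :=
  Measure.pi fun _ => bitSequenceLaw

/-- Weak `c`-coloring of oriented 4-regular trees with `n` nodes is solvable by a randomized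
`t`-round algorithm with global success probability at least `p`, where the nodes are given unique
identifiers from a set of exactly `n` elements: one algorithm has to produce a weak `c`-coloring of
the whole tree with probability at least `p`, on every tree and for every assignment of
identifiers. -/
def WeakColoringSolvable (c n t : ℕ) (p : ℝ≥0∞) : Prop :=
  ∃ A : LocalAlgorithm n t c, ∀ (V : Type) [Fintype V] (G : OrientedTree V) (ids : V ≃ Fin n),
    p ≤ bitsLaw V {ω | IsWeakColoring G.graph (A.run G ids ω)}

set_option linter.unusedSectionVars false

/-! The argument is round elimination on the infinite 4-regular tree, the Cayley graph of the free
group on two generators, with i.i.d. node labels of arbitrary law `ν`; shifts by group elements make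
the rule the same at every node.

Suppose a node rule of radius `t + 1` fails at a node with probability at most `δ ^ 5`. Let each
edge, seeing only its radius-`t` surroundings, list the colors that have conditional probability at
least `δ` at either end. The four branches at a node are conditionally independent, so whenever the
lists on opposite edges agree and contain the node's own color, all four neighbors repeat that color
with conditional probability at least `δ ^ 4`. This situation therefore has probability at most `δ`.
A color that is not listed costs at most `δ` per color and edge. So opposite edges rarely get equal
lists (`exists_edge_coloring_of_node_coloring`). The same device passes from edges back to nodes and
lands at radius `t` (`exists_node_coloring_of_edge_coloring`). Each half-step makes the palette
exponentially larger. At radius `0` neighboring colors are independent, and failure has probability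
at least `c⁻⁵`. Hence a rule of radius `t` fails with probability above `D⁻ᵉ`, where `e =
failureExponent t` and `D` is bounded by a tower of height linear in `t`
(`inv_pow_lt_measure_nodeFailure`). This bound does not depend on `ν`, which matters because the
identifiers range over `n` values.

To reach finite trees, a tree with exactly `n` nodes is cut out of the infinite one so that its
interior contains `m` disjoint balls on a line. Uniform random identifiers are distinct on these
balls with probability at least one half, and then extend to a legal assignment, for which the
algorithm succeeds with probability at least one half. If `q` is the failure probability at a node,
then `1 / 4 ≤ (1 - q) ^ m`, so `m * q ≤ 3` (`measure_nodeFailure_infiniteRule_le`). For `m = 3 * D ^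
e` this contradicts the lower bound on `q`; there is room for that many balls once `twoTower (2 * t
+ 7) < n`. -/

/-- The law of a family of independent labels with law `ν`. -/
noncomputable abbrev iidLaw (ι : Type*) {Ω : Type*} [MeasurableSpace Ω] (ν : Measure Ω) :
    Measure (ι → Ω) :=
  Measure.infinitePi fun _ : ι => ν

/-! ### Conditional probabilities in product measures, defined by resampling coordinates. -/

section CondProb

variable {ι Ω : Type*} [MeasurableSpace Ω] (ν : Measure Ω) [IsProbabilityMeasure ν]

open Classical in
lemma measurable_piecewise_prod (A : Set ι) :
    Measurable fun p : (ι → Ω) × (ι → Ω) => A.piecewise p.1 p.2 := by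
  refine measurable_pi_lambda _ fun i => ?_
  by_cases h : i ∈ A
  · simp only [Set.piecewise, h, if_true]; fun_prop
  · simp only [Set.piecewise, h, if_false]; fun_prop

open Classical in
/-- Resampling the coordinates outside `A` preserves a product measure. -/
lemma map_piecewise_infinitePi (A : Set ι) :
    ((iidLaw ι ν).prod (iidLaw ι ν)).map
      (fun p => A.piecewise p.1 p.2) = iidLaw ι ν := by
  refine Measure.eq_infinitePi _ fun s t ht => ?_
  rw [Measure.map_apply (measurable_piecewise_prod A) (.pi s.countable_toSet fun _ _ => ht _)]
  have : (fun p : (ι → Ω) × (ι → Ω) => A.piecewise p.1 p.2) ⁻¹' (Set.pi s t) =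
      (Set.pi (s.filter (· ∈ A) : Finset ι) t) ×ˢ (Set.pi (s.filter (· ∉ A) : Finset ι) t) := by
    ext p
    simp only [Set.mem_preimage, Set.mem_pi, Set.mem_prod, Finset.mem_coe, Finset.mem_filter]
    constructor
    · intro h
      refine ⟨fun i hi => ?_, fun i hi => ?_⟩
      · simpa [Set.piecewise, hi.2] using h i hi.1
      · simpa [Set.piecewise, hi.2] using h i hi.1
    · rintro ⟨h1, h2⟩ i hi
      by_cases hA : i ∈ A
      · simpa [Set.piecewise, hA] using h1 i ⟨hi, hA⟩
      · simpa [Set.piecewise, hA] using h2 i ⟨hi, hA⟩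
  rw [this, Measure.prod_prod, Measure.infinitePi_pi _ fun i _ => ht i,
    Measure.infinitePi_pi _ fun i _ => ht i, Finset.prod_filter_mul_prod_filter_not]

open Classical in
/-- The conditional probability of `S` given the coordinates in `A`. -/
noncomputable def condProb (A : Set ι) (S : Set (ι → Ω)) (x : ι → Ω) : ℝ≥0∞ :=
  iidLaw ι ν {y | A.piecewise x y ∈ S}

variable {ν}
variable {A B C : Set ι} {S T : Set (ι → Ω)} {x : ι → Ω}

lemma measurable_condProb (hS : MeasurableSet S) : Measurable (condProb ν A S) := by
  classical
  exact measurable_measure_prodMk_left (measurable_piecewise_prod A hS)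

/-- Total probability: resampling outside `A` does not change the law, and Fubini separates the kept
coordinates from the fresh ones. -/
lemma measure_eq_lintegral_condProb (A : Set ι) (hS : MeasurableSet S) :
    iidLaw ι ν S = ∫⁻ x, condProb ν A S x ∂iidLaw ι ν := by
  classical
  conv_lhs => rw [← map_piecewise_infinitePi ν A]
  rw [Measure.map_apply (measurable_piecewise_prod A) hS,
    Measure.prod_apply (measurable_piecewise_prod A hS)]
  rfl

lemma dependsOn_condProb : DependsOn (condProb ν A S) A := by
  classical
  intro x y h
  have : ∀ z, A.piecewise x z = A.piecewise y z := fun z => by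
    ext i
    by_cases hi : i ∈ A <;> simp [hi, h]
  simp only [condProb, this]

lemma condProb_mono (h : S ⊆ T) : condProb ν A S x ≤ condProb ν A T x :=
  measure_mono fun _ hy => h hy

lemma condProb_inter_of_mem (hT : DependsOn (· ∈ T) A) (hx : x ∈ T) :
    condProb ν A (T ∩ S) x = condProb ν A S x := by
  classical
  unfold condProb
  congr 1
  ext y
  have : A.piecewise x y ∈ T ↔ x ∈ T := iff_of_eq <| hT fun i hi => by simp [hi]
  simp [this, hx]

lemma condProb_inter_of_notMem (hT : DependsOn (· ∈ T) A) (hx : x ∉ T) :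
    condProb ν A (T ∩ S) x = 0 := by
  classical
  unfold condProb
  rw [← measure_empty (μ := iidLaw ι ν)]
  congr 1
  ext y
  have : A.piecewise x y ∈ T ↔ x ∈ T := iff_of_eq <| hT fun i hi => by simp [hi]
  simp [this, hx]

/-- Coordinates irrelevant to `S` may be dropped from the conditioning. -/
lemma condProb_eq_of_inter_subset (hS : DependsOn (· ∈ S) C) (h : C ∩ B ⊆ A) (hAB : A ⊆ B) :
    condProb ν B S = condProb ν A S := by
  classical
  ext x
  unfold condProb
  congr 1
  ext y
  refine iff_of_eq <| hS fun i hi => ?_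
  by_cases hA : i ∈ A
  · simp [hA, hAB hA]
  · have : i ∉ B := fun hB => hA (h ⟨hi, hB⟩)
    simp [hA, this]

lemma condProb_empty : condProb ν ∅ S x = iidLaw ι ν S := by
  classical
  simp [condProb]

/-- Events depending on disjoint sets of coordinates are independent. -/
lemma measure_inter_of_dependsOn_disjoint (hS : MeasurableSet S) (hT : MeasurableSet T)
    (dS : DependsOn (· ∈ S) A) (dT : DependsOn (· ∈ T) B) (h : Disjoint A B) :
    iidLaw ι ν (S ∩ T) = iidLaw ι ν S * iidLaw ι ν T := by
  classical
  -- Given the coordinates in `A`, the event `S` is decided, while none of the coordinates of `T` is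
  -- fixed.
  have key : ∀ x, condProb ν A (S ∩ T) x = S.indicator (fun _ => iidLaw ι ν T) x := fun x => by
    by_cases hx : x ∈ S
    · rw [condProb_inter_of_mem dS hx, Set.indicator_of_mem hx,
        condProb_eq_of_inter_subset (A := ∅) dT (by rw [Set.inter_comm, h.inter_eq])
          (Set.empty_subset _), condProb_empty]
    · rw [condProb_inter_of_notMem dS hx, Set.indicator_of_notMem hx]
  rw [measure_eq_lintegral_condProb A (hS.inter hT)]
  simp_rw [key]
  rw [lintegral_indicator hS, lintegral_const]
  simp [mul_comm]

lemma measure_biInter_of_dependsOn_disjoint {κ : Type*} {S : κ → Set (ι → Ω)} {A : κ → Set ι}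
    (s : Finset κ) (hS : ∀ k, MeasurableSet (S k)) (dS : ∀ k, DependsOn (· ∈ S k) (A k))
    (h : ∀ k l, k ≠ l → Disjoint (A k) (A l)) :
    iidLaw ι ν (⋂ k ∈ s, S k) = ∏ k ∈ s, iidLaw ι ν (S k) := by
  classical
  induction s using Finset.induction_on with
  | empty => simp
  | insert k s hk ih =>
    rw [Finset.set_biInter_insert, Finset.prod_insert hk, ← ih]
    refine measure_inter_of_dependsOn_disjoint (B := ⋃ l ∈ s, A l) (hS k)
      (Finset.measurableSet_biInter s fun l _ => hS l) (dS k) ?_ ?_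
    · intro x y hxy
      simp only [Set.mem_iInter]
      refine forall_congr fun l => ?_
      refine forall_congr fun hl => ?_
      exact dS l fun i hi => hxy i (Set.mem_biUnion hl hi)
    · rw [Set.disjoint_iUnion₂_right]
      exact fun l hl => h _ _ fun e => hk (e ▸ hl)

/-- Conditional independence of events whose coordinate sets only meet inside `A`. -/
lemma condProb_iInter {κ : Type*} [Fintype κ] {S : κ → Set (ι → Ω)} {C : κ → Set ι}
    (hS : ∀ k, MeasurableSet (S k)) (dS : ∀ k, DependsOn (· ∈ S k) (C k))
    (h : ∀ k l, k ≠ l → C k ∩ C l ⊆ A) :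
    condProb ν A (⋂ k, S k) x = ∏ k, condProb ν A (S k) x := by
  classical
  unfold condProb
  -- Once the coordinates in `A` are frozen at `x`, the events depend on the pairwise disjoint sets
  -- `C k \ A`.
  have := measure_biInter_of_dependsOn_disjoint (ν := ν) (S := fun k => {y | A.piecewise x y ∈ S k})
    (A := fun k => C k \ A) Finset.univ
    (fun k => (measurable_piecewise_prod A).comp measurable_prodMk_left (hS k)) ?_ ?_
  · rw [← this]
    congr 1
    ext y
    simp
  · intro k y z hyz
    refine dS k fun i hi => ?_
    by_cases hA : i ∈ A
    · simp [hA]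
    · simp [hA, hyz i ⟨hi, hA⟩]
  · intro k l hkl
    rw [Set.disjoint_left]
    exact fun i hi hi' => hi.2 (h k l hkl ⟨hi.1, hi'.1⟩)

/-- The threshold event is decided by the coordinates in `A`, so it factors out of the conditional
probability, which is below `δ` wherever the event holds. -/
lemma measure_inter_condProb_lt_le (hS : MeasurableSet S) (A : Set ι) (δ : ℝ≥0∞) :
    iidLaw ι ν (S ∩ {x | condProb ν A S x < δ}) ≤ δ := by
  have hT : MeasurableSet {x | condProb ν A S x < δ} :=
    measurableSet_lt (measurable_condProb hS) measurable_const
  have dT : DependsOn (· ∈ {x | condProb ν A S x < δ}) A := fun x y h => by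
    simp [dependsOn_condProb h]
  rw [Set.inter_comm, measure_eq_lintegral_condProb A (hT.inter hS)]
  calc _ ≤ ∫⁻ _, δ ∂iidLaw ι ν := by
        refine lintegral_mono fun x => ?_
        by_cases hx : x ∈ {x | condProb ν A S x < δ}
        · rw [condProb_inter_of_mem dT hx]; exact hx.le
        · rw [condProb_inter_of_notMem dT hx]; exact zero_le
    _ = δ := by simp

/-- Markov's inequality for the conditional probability. It turns pointwise lower bounds on the
conditional failure into upper bounds on how often they apply. -/
lemma mul_measure_le_of_le_condProb (hS : MeasurableSet S) (ε : ℝ≥0∞)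
    (h : ∀ x ∈ T, ε ≤ condProb ν A S x) : ε * iidLaw ι ν T ≤ iidLaw ι ν S := by
  rw [measure_eq_lintegral_condProb A hS]
  calc _ ≤ ε * iidLaw ι ν {x | ε ≤ condProb ν A S x} := by
        gcongr
        exact h
    _ ≤ _ := mul_meas_ge_le_lintegral (measurable_condProb hS) ε

/-- If a random color has conditional probability below `δ` given the coordinates in `A`, it is
rarely attained. -/
lemma measure_condProb_color_lt_le {K : Type*} [Fintype K] {f : (ι → Ω) → K}
    (hf : ∀ a, MeasurableSet {x | f x = a}) (A : Set ι) (δ : ℝ≥0∞) :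
    iidLaw ι ν {x | condProb ν A {y | f y = f x} x < δ} ≤ Fintype.card K * δ := by
  calc _ ≤ iidLaw ι ν (⋃ a : K, {x | f x = a} ∩ {x | condProb ν A {y | f y = a} x < δ}) :=
        measure_mono fun x hx => Set.mem_iUnion.2 ⟨f x, rfl, hx⟩
    _ ≤ ∑ a : K, iidLaw ι ν ({x | f x = a} ∩ {x | condProb ν A {y | f y = a} x < δ}) :=
        measure_iUnion_fintype_le _ _
    _ ≤ ∑ _a : K, δ := Finset.sum_le_sum fun a _ => measure_inter_condProb_lt_le (hf a) A δ
    _ = _ := by simp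

end CondProb

/-! ### The 4-regular tree as the Cayley graph of the free group: balls and edge neighborhoods. -/

section FreeGroupGeometry

/-- The signed letter of the free group on two generators that corresponds to a direction. -/
def Dir.letter : Dir → Bool × Bool
  | .U => (true, true)
  | .D => (true, false)
  | .L => (false, false)
  | .R => (false, true)

/-- The generator of the free group, or its inverse, that corresponds to a direction. -/
def Dir.gen (x : Dir) : FreeGroup Bool := FreeGroup.mk [x.letter]

lemma Dir.letter_injective : Function.Injective Dir.letter := by
  intro x y h
  cases x <;> cases y <;> simp_all [Dir.letter]

lemma Dir.letter_surjective : Function.Surjective Dir.letter := by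
  rintro ⟨a, b⟩
  cases a <;> cases b
  exacts [⟨.L, rfl⟩, ⟨.R, rfl⟩, ⟨.D, rfl⟩, ⟨.U, rfl⟩]

lemma Dir.gen_opp (x : Dir) : x.opp.gen = x.gen⁻¹ := by
  cases x <;> simp [Dir.gen, Dir.opp, Dir.letter, FreeGroup.invRev]

@[simp] lemma Dir.opp_opp (x : Dir) : x.opp.opp = x := by cases x <;> rfl

@[simp] lemma Dir.gen_mul_gen_opp (x : Dir) : x.gen * x.opp.gen = 1 := by simp [Dir.gen_opp]

lemma Dir.gen_injective : Function.Injective Dir.gen := by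
  intro x y h
  have := congrArg FreeGroup.toWord h
  simp only [Dir.gen, FreeGroup.toWord_mk, FreeGroup.reduce_singleton] at this
  exact Dir.letter_injective (by simpa using this)

/-- A letter put before a reduced word either cancels the first letter or leaves a reduced word. The
tree geometry below rests on this dichotomy. -/
lemma toWord_gen_mul (x : Dir) (h : FreeGroup Bool) :
    (∃ l, h.toWord = x.opp.letter :: l ∧ (x.gen * h).toWord = l) ∨
      ((∀ l, h.toWord ≠ x.opp.letter :: l) ∧ (x.gen * h).toWord = x.letter :: h.toWord) := by
  have h1 : (x.gen * h).toWord = FreeGroup.reduce (x.letter :: h.toWord) := by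
    rw [FreeGroup.toWord_mul, Dir.gen, FreeGroup.toWord_mk]
    rfl
  rw [h1, FreeGroup.reduce.cons, FreeGroup.reduce_toWord]
  rcases hw : h.toWord with _ | ⟨y, l⟩
  · right; simp
  · by_cases hy : y = x.opp.letter
    · left
      refine ⟨l, by rw [hy], ?_⟩
      subst hy
      have : x.letter.1 = x.opp.letter.1 ∧ x.letter.2 = !x.opp.letter.2 := by
        cases x <;> simp [Dir.letter, Dir.opp]
      simp [this]
    · right
      refine ⟨fun l' hl' => hy (by simpa using (List.cons.inj hl').1), ?_⟩
      have : ¬ (x.letter.1 = y.1 ∧ x.letter.2 = !y.2) := by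
        rintro ⟨h1, h2⟩
        apply hy
        obtain ⟨y1, y2⟩ := y
        cases x <;> cases y1 <;> cases y2 <;> simp_all [Dir.letter, Dir.opp]
      simp [this]

lemma norm_gen_mul (x : Dir) (h : FreeGroup Bool) :
    (x.gen * h).norm = h.norm + 1 ∨ (x.gen * h).norm + 1 = h.norm := by
  rcases toWord_gen_mul x h with ⟨l, h1, h2⟩ | ⟨-, h2⟩
  · right; simp [FreeGroup.norm, h1, h2]
  · left; simp [FreeGroup.norm, h2]

/-- Shortening requires cancelling the first letter of the reduced word, and there is only one such
letter. This is uniqueness of geodesics in the tree. -/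
lemma eq_of_norm_gen_mul_lt {x y : Dir} {h : FreeGroup Bool} (hx : (x.gen * h).norm < h.norm)
    (hy : (y.gen * h).norm < h.norm) : x = y := by
  rcases toWord_gen_mul x h with ⟨l, h1, h2⟩ | ⟨-, h2⟩
  · rcases toWord_gen_mul y h with ⟨l', h1', h2'⟩ | ⟨-, h2'⟩
    · rw [h1] at h1'
      have := Dir.letter_injective (List.cons.inj h1').1
      rw [← x.opp_opp, this, y.opp_opp]
    · simp [FreeGroup.norm, h2'] at hy
  · simp [FreeGroup.norm, h2] at hx

lemma exists_norm_gen_mul_lt {h : FreeGroup Bool} (hh : h ≠ 1) :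
    ∃ x : Dir, (x.gen * h).norm < h.norm := by
  rcases hw : h.toWord with _ | ⟨y, l⟩
  · exact absurd (FreeGroup.toWord_eq_nil_iff.1 hw) hh
  · obtain ⟨x, hx⟩ := Dir.letter_surjective y
    refine ⟨x.opp, ?_⟩
    rcases toWord_gen_mul x.opp h with ⟨l', h1, h2⟩ | ⟨h1, -⟩
    · simp [FreeGroup.norm, h1, h2]
    · exact absurd (by simp [hw, hx]) (h1 l)

lemma norm_gen (x : Dir) : x.gen.norm = 1 := by
  simp [FreeGroup.norm, Dir.gen, FreeGroup.toWord_mk]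

lemma norm_mul_gen_eq_norm_gen_mul_inv (h : FreeGroup Bool) (x : Dir) :
    (h * x.gen).norm = (x.opp.gen * h⁻¹).norm := by
  rw [← FreeGroup.norm_inv_eq, mul_inv_rev, Dir.gen_opp]

lemma norm_mul_gen (h : FreeGroup Bool) (x : Dir) :
    (h * x.gen).norm = h.norm + 1 ∨ (h * x.gen).norm + 1 = h.norm := by
  simpa [norm_mul_gen_eq_norm_gen_mul_inv] using norm_gen_mul x.opp h⁻¹

lemma eq_of_norm_mul_gen_lt {x y : Dir} {h : FreeGroup Bool} (hx : (h * x.gen).norm < h.norm)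
    (hy : (h * y.gen).norm < h.norm) : x = y := by
  rw [norm_mul_gen_eq_norm_gen_mul_inv, ← FreeGroup.norm_inv_eq (x := h)] at hx hy
  rw [← x.opp_opp, eq_of_norm_gen_mul_lt hx hy, y.opp_opp]

lemma exists_norm_mul_gen_lt {h : FreeGroup Bool} (hh : h ≠ 1) :
    ∃ x : Dir, (h * x.gen).norm < h.norm := by
  obtain ⟨x, hx⟩ := exists_norm_gen_mul_lt (inv_ne_one.2 hh)
  exact ⟨x.opp, by simpa [norm_mul_gen_eq_norm_gen_mul_inv] using hx⟩

/-- The ball of radius `t` around `g` in the 4-regular tree. -/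
def treeBall (g : FreeGroup Bool) (t : ℕ) : Set (FreeGroup Bool) := {h | (g⁻¹ * h).norm ≤ t}

/-- The nodes within distance `t` of an end of the edge in direction `x` at the node `1`. -/
def edgeBall (x : Dir) (t : ℕ) : Set (FreeGroup Bool) := treeBall 1 t ∪ treeBall x.gen t

variable {t : ℕ} {x y : Dir}

lemma mem_treeBall_gen {h : FreeGroup Bool} :
    h ∈ treeBall x.gen t ↔ (x.opp.gen * h).norm ≤ t := by
  simp [treeBall, Dir.gen_opp]

lemma mem_treeBall_one {h : FreeGroup Bool} : h ∈ treeBall 1 t ↔ h.norm ≤ t := by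
  simp [treeBall]

/-- The distances from a node to the two ends of an edge differ by exactly one, so if both are at
most `t + 1`, the smaller is at most `t`. -/
lemma treeBall_inter_subset_edgeBall : treeBall x.gen (t + 1) ∩ treeBall 1 (t + 1) ⊆ edgeBall x t := by
  rintro h ⟨h1, h2⟩
  rw [mem_treeBall_gen] at h1
  rw [mem_treeBall_one] at h2
  rw [edgeBall, Set.mem_union, mem_treeBall_gen, mem_treeBall_one]
  have := norm_gen_mul x.opp h
  omega

/-- A node farther than `t` from `1` but within `t` of two neighbors of `1` would have two geodesics
to `1`. This gives conditional independence of the neighbors' colors. -/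
lemma treeBall_gen_inter_subset (hxy : x ≠ y) :
    treeBall x.gen t ∩ treeBall y.gen t ⊆ treeBall 1 t := by
  rintro h ⟨h1, h2⟩
  rw [mem_treeBall_gen] at h1 h2
  rw [mem_treeBall_one]
  by_contra hh
  refine hxy ?_
  rw [← x.opp_opp, eq_of_norm_gen_mul_lt (x := x.opp) (y := y.opp) (h := h) (by omega) (by omega),
    y.opp_opp]

/-- Gives conditional independence of the four edge colors at a node. -/
lemma edgeBall_inter_subset (hxy : x ≠ y) : edgeBall x t ∩ edgeBall y t ⊆ treeBall 1 t := by
  rintro h ⟨h1 | h1, h2 | h2⟩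
  exacts [h1, h1, h2, treeBall_gen_inter_subset hxy ⟨h1, h2⟩]

lemma treeBall_gen_subset : treeBall x.gen t ⊆ treeBall 1 (t + 1) := by
  intro h h1
  rw [mem_treeBall_gen] at h1
  rw [mem_treeBall_one]
  have := norm_gen_mul x.opp h
  omega

lemma treeBall_mono {g : FreeGroup Bool} {s t : ℕ} (h : s ≤ t) : treeBall g s ⊆ treeBall g t :=
  fun _ hk => le_trans (show _ ≤ s from hk) h

lemma edgeBall_subset : edgeBall x t ⊆ treeBall 1 (t + 1) :=
  Set.union_subset (treeBall_mono t.le_succ) treeBall_gen_subset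

lemma mul_mem_treeBall {g h k : FreeGroup Bool} : g * h ∈ treeBall (g * k) t ↔ h ∈ treeBall k t := by
  simp [treeBall, mul_assoc]

lemma gen_mul_mem_treeBall {h : FreeGroup Bool} : x.gen * h ∈ treeBall x.gen t ↔ h ∈ treeBall 1 t := by
  rw [← mul_mem_treeBall (g := x.gen) (k := 1), mul_one]

lemma gen_mul_mem_edgeBall {h : FreeGroup Bool} : x.gen * h ∈ edgeBall x t ↔ h ∈ edgeBall x.opp t := by
  have h1 : x.gen * h ∈ treeBall 1 t ↔ h ∈ treeBall x.opp.gen t := by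
    rw [← mul_mem_treeBall (g := x.gen) (k := x.opp.gen), Dir.gen_mul_gen_opp]
  rw [edgeBall, edgeBall, Set.mem_union, Set.mem_union, h1, gen_mul_mem_treeBall, or_comm]

end FreeGroupGeometry

/-! ### Shift invariance of i.i.d. labelings. -/

section Shift

variable {Γ Ω : Type*} [Group Γ]

/-- The labeling seen from the node `g`. -/
def shift (g : Γ) (ω : Γ → Ω) : Γ → Ω := fun h => ω (g * h)

lemma shift_shift (g h : Γ) (ω : Γ → Ω) : shift h (shift g ω) = shift (g * h) ω := by
  funext k
  simp [shift, mul_assoc]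

@[simp] lemma shift_one (ω : Γ → Ω) : shift 1 ω = ω := by
  funext k
  simp [shift]

lemma DependsOn.comp_shift {β : Type*} {f : (Γ → Ω) → β} {A B : Set Γ} (hf : DependsOn f A) (g : Γ)
    (h : ∀ k ∈ A, g * k ∈ B) : DependsOn (fun ω => f (shift g ω)) B :=
  fun _ _ hxy => hf fun k hk => hxy _ (h k hk)

variable [MeasurableSpace Ω] (ν : Measure Ω) [IsProbabilityMeasure ν]

@[fun_prop]
lemma measurable_shift (g : Γ) : Measurable (shift g : (Γ → Ω) → (Γ → Ω)) :=
  measurable_pi_lambda _ fun _ => measurable_pi_apply _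

lemma measurePreserving_shift (g : Γ) :
    MeasurePreserving (shift g) (iidLaw Γ ν) (iidLaw Γ ν) := by
  refine ⟨measurable_shift g, ?_⟩
  have := Measure.infinitePi_map_piCongrLeft (X := fun _ : Γ => Ω) (fun _ : Γ => ν)
    (Equiv.mulLeft g⁻¹)
  convert this using 2
  funext ω k
  have := MeasurableEquiv.piCongrLeft_apply_apply (β := fun _ : Γ => Ω) (Equiv.mulLeft g⁻¹) ω (g * k)
  simp only [Equiv.coe_mulLeft, inv_mul_cancel_left] at this
  rw [this, shift]

/-- The i.i.d. law is shift invariant, so the resampled labeling may be shifted along with the fixed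
one. -/
lemma condProb_shift (A B : Set Γ) (S : Set (Γ → Ω)) (hS : MeasurableSet S) (g : Γ)
    (h : ∀ k, g * k ∈ B ↔ k ∈ A) (ω : Γ → Ω) :
    condProb ν A S (shift g ω) = condProb ν B (shift g ⁻¹' S) ω := by
  classical
  unfold condProb
  have hm : MeasurableSet {y | A.piecewise (shift g ω) y ∈ S} :=
    (measurable_piecewise_prod A).comp measurable_prodMk_left hS
  rw [← (measurePreserving_shift ν g).measure_preimage hm.nullMeasurableSet]
  congr 1
  ext y
  simp only [Set.mem_preimage, Set.mem_ofPred_eq]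
  have : A.piecewise (shift g ω) (shift g y) = shift g (B.piecewise ω y) := by
    funext k
    by_cases hk : k ∈ A
    · simp [shift, hk, h]
    · simp [shift, hk, h]
  rw [this]

end Shift

/-! ### Round elimination and the local lower bound on the failure probability. -/

section RoundElimination

variable {Ω : Type*} [MeasurableSpace Ω] {ν : Measure Ω} [IsProbabilityMeasure ν]

lemma measurableSet_setOf_eq_set {X C : Type*} [MeasurableSpace X] [Finite C] {p : C → X → Prop}
    (hp : ∀ a, MeasurableSet {x | p a x}) (s : Set C) : MeasurableSet {x | {a | p a x} = s} := by
  have : {x | {a | p a x} = s} = ⋂ a, {x | p a x ↔ a ∈ s} := by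
    ext x
    simp [Set.ext_iff]
  rw [this]
  exact MeasurableSet.iInter fun a => (hp a).iff (MeasurableSet.const _)

/-- The labelings for which the node `1` has the same color as all its neighbors. -/
def nodeFailure {C : Type*} (f : (FreeGroup Bool → Ω) → C) : Set (FreeGroup Bool → Ω) :=
  {ω | ∀ x : Dir, f (shift x.gen ω) = f ω}

/-- The labelings for which opposite edges at the node `1` have equal colors. -/
def edgeFailure {K : Type*} (g : Dir → (FreeGroup Bool → Ω) → K) : Set (FreeGroup Bool → Ω) :=
  {ω | g .U ω = g .D ω ∧ g .L ω = g .R ω}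

lemma measurableSet_shift_eq {Γ C : Type*} [Group Γ] {f : (Γ → Ω) → C}
    (hf : ∀ a, MeasurableSet {ω | f ω = a}) (g : Γ) (a : C) :
    MeasurableSet {ω | f (shift g ω) = a} :=
  measurable_shift g (hf a)

lemma measurableSet_eq_fun' {X C : Type*} [MeasurableSpace X] [Countable C] {f g : X → C}
    (hf : ∀ a, MeasurableSet {ω | f ω = a}) (hg : ∀ a, MeasurableSet {ω | g ω = a}) :
    MeasurableSet {ω | f ω = g ω} := by
  have : {ω | f ω = g ω} = ⋃ a, {ω | f ω = a} ∩ {ω | g ω = a} := by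
    ext ω
    simp [eq_comm]
  rw [this]
  exact MeasurableSet.iUnion fun a => (hf a).inter (hg a)

lemma measurableSet_nodeFailure {C : Type*} [Countable C] {f : (FreeGroup Bool → Ω) → C}
    (hf : ∀ a, MeasurableSet {ω | f ω = a}) : MeasurableSet (nodeFailure f) := by
  have : nodeFailure f = ⋂ x : Dir, {ω | f (shift x.gen ω) = f ω} := by
    ext ω
    simp [nodeFailure]
  rw [this]
  exact MeasurableSet.iInter fun x => measurableSet_eq_fun' (measurableSet_shift_eq hf _) hf

lemma DependsOn.mem_setOf_eq {ι C : Type*} {f : (ι → Ω) → C} {A : Set ι} (hf : DependsOn f A)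
    (a : C) : DependsOn (· ∈ {ω | f ω = a}) A := fun _ _ h => by simp [hf h]

/-- Source of the fifth powers: four factors are the price of four conditionally independent events,
and the fifth remains as the bound. -/
lemma le_of_pow_four_mul_le {δ a : ℝ≥0∞} (h0 : δ ≠ 0) (h1 : δ ≠ ∞) (h : δ ^ 4 * a ≤ δ ^ 5) :
    a ≤ δ := by
  rw [pow_succ δ 4] at h
  exact (ENNReal.mul_le_mul_iff_right (pow_ne_zero 4 h0) (ENNReal.pow_ne_top h1)).1 h

variable {t : ℕ} {δ : ℝ≥0∞}

lemma pow_four_le_condProb_iInter {A : Set (FreeGroup Bool)} {S : Dir → Set (FreeGroup Bool → Ω)}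
    {C : Dir → Set (FreeGroup Bool)} {ω : FreeGroup Bool → Ω}
    (hS : ∀ x, MeasurableSet (S x)) (dS : ∀ x, DependsOn (· ∈ S x) (C x))
    (h : ∀ x y, x ≠ y → C x ∩ C y ⊆ A) (hδ : ∀ x, δ ≤ condProb ν A (S x) ω) :
    δ ^ 4 ≤ condProb ν A (⋂ x, S x) ω := by
  rw [condProb_iInter hS dS h]
  calc δ ^ 4 = ∏ _x : Dir, δ := by
        rw [Finset.prod_const]
        rfl
    _ ≤ _ := Finset.prod_le_prod' fun x _ => hδ x

/-- A node coloring with radius `t + 1` yields an edge coloring with radius `t + 1 / 2`. -/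
lemma exists_edge_coloring_of_node_coloring {C : Type} [Fintype C] {f : (FreeGroup Bool → Ω) → C}
    (hf : ∀ a, MeasurableSet {ω | f ω = a}) (df : DependsOn f (treeBall 1 (t + 1)))
    (h0 : δ ≠ 0) (h1 : δ ≠ ∞) (hδ : iidLaw _ ν (nodeFailure f) ≤ δ ^ 5) :
    ∃ g : Dir → (FreeGroup Bool → Ω) → Set C × Set C,
      (∀ x a, MeasurableSet {ω | g x ω = a}) ∧ (∀ x, DependsOn (g x) (edgeBall x t)) ∧
      (∀ x ω, g x.opp (shift x.gen ω) = g x ω) ∧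
      iidLaw _ ν (edgeFailure g) ≤ (4 * Fintype.card C + 1) * δ := by
  -- `near` and `far` list the likely colors of the two ends of the edge, judged from what the edge
  -- sees; the two ends of the edge exchange their roles.
  set near : Dir → (FreeGroup Bool → Ω) → Set C :=
    fun x ω => {a | δ ≤ condProb ν (edgeBall x t) {ω | f ω = a} ω} with hnear
  set far : Dir → (FreeGroup Bool → Ω) → Set C :=
    fun x ω => {a | δ ≤ condProb ν (edgeBall x t) {ω | f (shift x.gen ω) = a} ω} with hfar
  have hfs : ∀ (x : Dir) (a), MeasurableSet {ω | f (shift x.gen ω) = a} := fun x a =>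
    measurableSet_shift_eq hf x.gen a
  have mnear : ∀ x s, MeasurableSet {ω | near x ω = s} := fun x s =>
    measurableSet_setOf_eq_set
      (fun a => measurableSet_le measurable_const (measurable_condProb (hf a))) s
  have mfar : ∀ x s, MeasurableSet {ω | far x ω = s} := fun x s =>
    measurableSet_setOf_eq_set
      (fun a => measurableSet_le measurable_const (measurable_condProb (hfs x a))) s
  have dnear : ∀ x, DependsOn (near x) (edgeBall x t) := fun x ω ω' h => by
    ext a
    simp [hnear, dependsOn_condProb h]
  have dfar : ∀ x, DependsOn (far x) (edgeBall x t) := fun x ω ω' h => by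
    ext a
    simp [hfar, dependsOn_condProb h]
  have near_shift : ∀ (x : Dir) ω, near x.opp (shift x.gen ω) = far x ω := fun x ω => by
    ext a
    simp only [hnear, hfar, Set.mem_ofPred_eq]
    rw [condProb_shift ν _ (edgeBall x t) _ (hf a) _ fun k => gen_mul_mem_edgeBall]
    rfl
  have far_shift : ∀ (x : Dir) ω, far x.opp (shift x.gen ω) = near x ω := fun x ω => by
    ext a
    simp only [hnear, hfar, Set.mem_ofPred_eq]
    rw [condProb_shift ν _ (edgeBall x t) _ (hfs x.opp a) _ fun k => gen_mul_mem_edgeBall]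
    simp only [Set.preimage_ofPred_eq, shift_shift, Dir.gen_mul_gen_opp, shift_one]
  have mpair : ∀ x (a : Set C × Set C), MeasurableSet {ω | (near x ω, far x ω) = a} := fun x a => by
    simp only [Prod.ext_iff]
    exact (mnear x a.1).inter (mfar x a.2)
  have mpair' : ∀ x (a : Set C × Set C), MeasurableSet {ω | (far x ω, near x ω) = a} := fun x a => by
    simp only [Prod.ext_iff]
    exact (mfar x a.1).inter (mnear x a.2)
  -- The orientation orders the pair: first the list of the lower or left end, then that of the
  -- upper or right end. Both ends thus compute the same edge color.
  refine ⟨fun x ω => match x with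
    | .U => (near .U ω, far .U ω)
    | .D => (far .D ω, near .D ω)
    | .L => (far .L ω, near .L ω)
    | .R => (near .R ω, far .R ω), ?_, ?_, ?_, ?_⟩
  · intro x
    cases x
    exacts [mpair _, mpair' _, mpair' _, mpair _]
  · intro x ω ω' h
    cases x <;> simp only [dnear _ h, dfar _ h]
  · intro x ω
    have h1 := near_shift x ω
    have h2 := far_shift x ω
    cases x <;> simp_all [Dir.opp]
  · have key : ∀ ω, ω ∈ edgeFailure (fun (x : Dir) ω => match x with
        | .U => (near .U ω, far .U ω)
        | .D => (far .D ω, near .D ω)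
        | .L => (far .L ω, near .L ω)
        | .R => (near .R ω, far .R ω)) → ∀ x : Dir, far x ω = near x.opp ω := by
      rintro ω ⟨hv, hh⟩ x
      simp only [Prod.ext_iff] at hv hh
      cases x
      exacts [hv.2, hv.1.symm, hh.1, hh.2.symm]
    set E := edgeFailure (fun (x : Dir) ω => match x with
        | .U => (near .U ω, far .U ω)
        | .D => (far .D ω, near .D ω)
        | .L => (far .L ω, near .L ω)
        | .R => (near .R ω, far .R ω))
    set bad : Dir → Set (FreeGroup Bool → Ω) :=
      fun x => {ω | condProb ν (edgeBall x t) {ω' | f ω' = f ω} ω < δ} with hbad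
    have hE : E ⊆ (⋃ x, bad x) ∪ {ω | ω ∈ E ∧ ∀ x, f ω ∈ near x ω} := by
      intro ω hω
      by_cases h : ∀ x, f ω ∈ near x ω
      · exact Or.inr ⟨hω, h⟩
      · push Not at h
        obtain ⟨x, hx⟩ := h
        have hx' : condProb ν (edgeBall x t) {ω' | f ω' = f ω} ω < δ := not_le.1 hx
        exact Or.inl (Set.mem_iUnion.2 ⟨x, hx'⟩)
    have hT : iidLaw _ ν {ω | ω ∈ E ∧ ∀ x, f ω ∈ near x ω} ≤ δ := by
      refine le_of_pow_four_mul_le h0 h1 (le_trans ?_ hδ)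
      -- The ball of radius `t + 1` fixes the node's own color and all the lists. By `key` the color
      -- is likely at every neighbor, and the neighbors are conditionally independent.
      refine mul_measure_le_of_le_condProb (A := treeBall 1 (t + 1))
        (measurableSet_nodeFailure hf) _ ?_
      rintro ω ⟨hω, hn⟩
      have h4 : δ ^ 4 ≤ condProb ν (treeBall 1 (t + 1))
          (⋂ x : Dir, {ω' | f (shift x.gen ω') = f ω}) ω := by
        refine pow_four_le_condProb_iInter (fun x => hfs x _) (C := fun x => treeBall x.gen (t + 1))
          (fun x => DependsOn.mem_setOf_eq (df.comp_shift _ fun k hk => ?_) _)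
          (fun x y hxy => treeBall_gen_inter_subset hxy) fun x => ?_
        · exact gen_mul_mem_treeBall.2 hk
        -- Of the larger ball, the neighbor's color can only use the part in its own ball, which
        -- lies in the edge ball; so the threshold defining `far` still applies.
        · rw [condProb_eq_of_inter_subset (C := treeBall x.gen (t + 1)) _
            treeBall_inter_subset_edgeBall edgeBall_subset]
          · have : f ω ∈ far x ω := by
              rw [key ω hω x]
              exact hn _
            exact this
          · refine DependsOn.mem_setOf_eq (df.comp_shift _ fun k hk => ?_) _
            exact gen_mul_mem_treeBall.2 hk
      refine h4.trans ?_
      rw [← condProb_inter_of_mem (T := {ω' | f ω' = f ω}) (df.mem_setOf_eq _) rfl]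
      refine condProb_mono ?_
      rintro ω' ⟨h5, h6⟩ x
      exact (Set.mem_iInter.1 h6 x).trans h5.symm
    calc _ ≤ iidLaw _ ν (⋃ x, bad x) + iidLaw _ ν {ω | ω ∈ E ∧ ∀ x, f ω ∈ near x ω} :=
          (measure_mono hE).trans (measure_union_le _ _)
      _ ≤ (∑ _x : Dir, Fintype.card C * δ) + δ := by
          refine add_le_add ((measure_iUnion_fintype_le _ _).trans ?_) hT
          exact Finset.sum_le_sum fun x _ => measure_condProb_color_lt_le hf _ _
      _ = _ := by
          rw [Finset.sum_const, show (Finset.univ : Finset Dir).card = 4 from rfl]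
          simp only [nsmul_eq_mul]
          push_cast
          ring

/-- An edge coloring with radius `t + 1 / 2` yields a node coloring with radius `t`. -/
lemma exists_node_coloring_of_edge_coloring {K : Type} [Fintype K]
    {g : Dir → (FreeGroup Bool → Ω) → K}
    (hg : ∀ x a, MeasurableSet {ω | g x ω = a}) (dg : ∀ x, DependsOn (g x) (edgeBall x t))
    (hopp : ∀ x ω, g x.opp (shift x.gen ω) = g x ω)
    (h0 : δ ≠ 0) (h1 : δ ≠ ∞) (hδ : iidLaw _ ν (edgeFailure g) ≤ δ ^ 5) :
    ∃ f : (FreeGroup Bool → Ω) → Dir → Set K,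
      (∀ a, MeasurableSet {ω | f ω = a}) ∧ DependsOn f (treeBall 1 t) ∧
      iidLaw _ ν (nodeFailure f) ≤ (4 * Fintype.card K + 1) * δ := by
  set S : Dir → (FreeGroup Bool → Ω) → Set K :=
    fun x ω => {b | δ ≤ condProb ν (treeBall 1 t) {ω' | g x ω' = b} ω} with hS
  have mS : ∀ x s, MeasurableSet {ω | S x ω = s} := fun x s =>
    measurableSet_setOf_eq_set
      (fun a => measurableSet_le measurable_const (measurable_condProb (hg x a))) s
  refine ⟨fun ω x => S x ω, fun a => ?_, fun ω ω' h => ?_, ?_⟩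
  · have : {ω | (fun x => S x ω) = a} = ⋂ x, {ω | S x ω = a x} := by
      ext ω
      simp [funext_iff]
    rw [this]
    exact MeasurableSet.iInter fun x => mS x _
  · funext x
    ext b
    simp [hS, dependsOn_condProb h]
  set bad : Dir → Set (FreeGroup Bool → Ω) :=
    fun x => {ω | condProb ν (treeBall 1 t) {ω' | g x ω' = g x ω} ω < δ} with hbad
  have hbadm : ∀ x, iidLaw _ ν (bad x) ≤ Fintype.card K * δ := fun x =>
    measure_condProb_color_lt_le (hg x) _ _
  have mbad : ∀ x, MeasurableSet (bad x) := fun x => by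
    have : bad x = ⋃ b, {ω | g x ω = b} ∩
        {ω | condProb ν (treeBall 1 t) {ω' | g x ω' = b} ω < δ} := by
      ext ω
      simp [hbad]
    rw [this]
    exact MeasurableSet.iUnion fun b => (hg x b).inter
      (measurableSet_lt (measurable_condProb (hg x b)) measurable_const)
  have hbads : ∀ x (k : FreeGroup Bool),
      iidLaw _ ν (shift k ⁻¹' bad x) ≤ Fintype.card K * δ := fun x k => by
    rw [(measurePreserving_shift ν k).measure_preimage (mbad x).nullMeasurableSet]
    exact hbadm x
  set T := {ω | (∃ b, b ∈ S .U ω ∧ b ∈ S .D ω) ∧ ∃ b, b ∈ S .L ω ∧ b ∈ S .R ω} with hT'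
  -- A candidate common to `U` and `D` and one common to `L` and `R` make all four edge colors match
  -- these candidates with conditional probability at least `δ ^ 4`.
  have hT : iidLaw _ ν T ≤ δ := by
    refine le_of_pow_four_mul_le h0 h1 (le_trans ?_ hδ)
    refine mul_measure_le_of_le_condProb (A := treeBall 1 t) ?_ _ ?_
    · exact (measurableSet_eq_fun' (hg _) (hg _)).inter (measurableSet_eq_fun' (hg _) (hg _))
    rintro ω ⟨⟨b, hbU, hbD⟩, b', hbL, hbR⟩
    refine le_trans (pow_four_le_condProb_iInter
      (S := fun x => {ω' | g x ω' = match x with | .U => b | .D => b | .L => b' | .R => b'})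
      (fun x => hg x _) (fun x => (dg x).mem_setOf_eq _)
      (fun x y hxy => edgeBall_inter_subset hxy) fun x => ?_) (condProb_mono ?_)
    · cases x
      exacts [hbU, hbD, hbL, hbR]
    · intro ω' h
      have h' := fun x => Set.mem_iInter.1 h x
      exact ⟨(h' .U).trans (h' .D).symm, (h' .L).trans (h' .R).symm⟩
  -- The edge to the upper neighbor is that neighbor's `D` edge. If its color is listed at both
  -- ends, then equal node colors put it in the node's own `D` list as well as its `U` list;
  -- likewise for `L` and `R`. Only the neighbors in directions `U` and `L` are needed.
  have hcover : nodeFailure (fun ω x => S x ω) ⊆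
      ((bad .U ∪ shift Dir.U.gen ⁻¹' bad .D) ∪ (bad .L ∪ shift Dir.L.gen ⁻¹' bad .R)) ∪ T := by
    intro ω hω
    by_contra hc
    simp only [Set.mem_union, not_or] at hc
    obtain ⟨⟨⟨hU, hD⟩, hL, hR⟩, hT⟩ := hc
    have hU' : δ ≤ condProb ν (treeBall 1 t) {ω' | g .U ω' = g .U ω} ω := not_lt.1 hU
    have hL' : δ ≤ condProb ν (treeBall 1 t) {ω' | g .L ω' = g .L ω} ω := not_lt.1 hL
    refine hT ⟨⟨g .U ω, hU', ?_⟩, g .L ω, hL', ?_⟩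
    · have := congrFun (hω .U) .D
      simp only at this
      rw [← this, ← hopp]
      have h' : δ ≤ condProb ν (treeBall 1 t) {ω' | g .D ω' = g .D (shift Dir.U.gen ω)}
        (shift Dir.U.gen ω) := not_lt.1 hD
      exact h'
    · have := congrFun (hω .L) .R
      simp only at this
      rw [← this, ← hopp]
      have h' : δ ≤ condProb ν (treeBall 1 t) {ω' | g .R ω' = g .R (shift Dir.L.gen ω)}
        (shift Dir.L.gen ω) := not_lt.1 hR
      exact h'
  calc _ ≤ _ := measure_mono hcover
    _ ≤ ((iidLaw _ ν (bad .U) + iidLaw _ ν (shift Dir.U.gen ⁻¹' bad .D)) +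
        (iidLaw _ ν (bad .L) + iidLaw _ ν (shift Dir.L.gen ⁻¹' bad .R))) + iidLaw _ ν T :=
      (measure_union_le _ _).trans (add_le_add_left ((measure_union_le _ _).trans
        (add_le_add (measure_union_le _ _) (measure_union_le _ _))) _)
    _ ≤ ((Fintype.card K * δ + Fintype.card K * δ) + (Fintype.card K * δ + Fintype.card K * δ)) + δ := by
      gcongr
      exacts [hbadm _, hbads _ _, hbadm _, hbads _ _]
    _ = _ := by ring

/-- A node coloring with radius `0` fails with probability at least `c ^ (-5)`. -/
lemma inv_card_pow_le_measure_nodeFailure {C : Type} [Fintype C] {f : (FreeGroup Bool → Ω) → C}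
    (hf : ∀ a, MeasurableSet {ω | f ω = a}) (df : DependsOn f (treeBall 1 0)) :
    ((Fintype.card C : ℝ≥0∞)⁻¹) ^ 5 ≤ iidLaw _ ν (nodeFailure f) := by
  have hne : Nonempty Ω := by
    by_contra h
    rw [not_nonempty_iff] at h
    have := measure_univ (μ := ν)
    simp [Set.univ_eq_empty_iff.2 h] at this
  have hneC : Nonempty C := ⟨f fun _ => hne.some⟩
  -- Pigeonhole: the color probabilities sum to at least one.
  obtain ⟨a, ha⟩ : ∃ a, (Fintype.card C : ℝ≥0∞)⁻¹ ≤ iidLaw _ ν {ω | f ω = a} := by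
    by_contra! h
    have h1 : (1 : ℝ≥0∞) ≤ ∑ a, iidLaw _ ν {ω | f ω = a} := by
      rw [← measure_univ (μ := iidLaw (FreeGroup Bool) ν)]
      refine (measure_mono fun ω _ => ?_).trans (measure_iUnion_fintype_le _ _)
      exact Set.mem_iUnion.2 ⟨f ω, rfl⟩
    have h2 : ∑ a, iidLaw _ ν {ω | f ω = a} < ∑ _a : C, (Fintype.card C : ℝ≥0∞)⁻¹ :=
      ENNReal.sum_lt_sum_of_nonempty Finset.univ_nonempty fun a _ => h a
    rw [Finset.sum_const, Finset.card_univ, nsmul_eq_mul,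
      ENNReal.mul_inv_cancel (by simp) (by simp)] at h2
    exact absurd h1 (not_le.2 h2)
  -- `none` stands for the node itself, giving five distinct nodes. At radius `0` their colors
  -- depend on disjoint coordinates.
  let s : Option Dir → FreeGroup Bool := fun o => o.elim 1 Dir.gen
  have hs : Function.Injective s := by
    have h1 : ∀ x : Dir, x.gen ≠ 1 := fun x h => by
      have := norm_gen x
      simp [h] at this
    rintro (_ | x) (_ | y) h
    · rfl
    · exact absurd h.symm (h1 y)
    · exact absurd h (h1 x)
    · exact congrArg some (Dir.gen_injective h)
  have hind := measure_biInter_of_dependsOn_disjoint (ν := ν) (S := fun o => {ω | f (shift (s o) ω) = a})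
    (A := fun o => {s o}) Finset.univ (fun o => measurableSet_shift_eq hf _ _)
    (fun o => DependsOn.mem_setOf_eq (df.comp_shift _ fun k hk => ?_) _)
    (fun o o' h => by simpa using fun h' => h (hs h'))
  · calc _ ≤ ∏ o, iidLaw _ ν {ω | f (shift (s o) ω) = a} := by
          rw [show 5 = (Finset.univ : Finset (Option Dir)).card from rfl, ← Finset.prod_const]
          refine Finset.prod_le_prod' fun o _ => ha.trans_eq ?_
          exact ((measurePreserving_shift ν (s o)).measure_preimage (hf a).nullMeasurableSet).symm
      _ = _ := hind.symm
      _ ≤ _ := by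
          refine measure_mono fun ω hω x => ?_
          simp only [Set.mem_iInter] at hω
          have h1 : f (shift (s (some x)) ω) = a := hω _ (Finset.mem_univ _)
          have h2 : f (shift (s none) ω) = a := hω _ (Finset.mem_univ _)
          have h3 : shift (s none) ω = ω := shift_one ω
          rw [h3] at h2
          exact h1.trans h2.symm
  · have : k = 1 := by simpa [mem_treeBall_one] using hk
    simp [this]

/-- The number of edge colors that one elimination step makes from `c` node colors. -/
def edgePalette (c : ℕ) : ℕ := 2 ^ c * 2 ^ c

/-- The number of node colors that one round of elimination makes from `c` node colors. -/
def nodePalette (c : ℕ) : ℕ := (2 ^ edgePalette c) ^ 4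

/-- The exponent of the failure probability that is needed for eliminating `t` rounds. -/
def failureExponent : ℕ → ℕ
  | 0 => 5
  | t + 1 => 5 * (5 * (failureExponent t + 1) + 1)

lemma le_edgePalette (c : ℕ) : c ≤ edgePalette c :=
  c.lt_two_pow_self.le.trans (Nat.le_mul_of_pos_right _ (by positivity))

lemma edgePalette_le_nodePalette (c : ℕ) : edgePalette c ≤ nodePalette c :=
  (edgePalette c).lt_two_pow_self.le.trans (Nat.le_self_pow (by norm_num) _)

lemma le_iterate_nodePalette (t c : ℕ) : c ≤ nodePalette^[t] c := by
  induction t generalizing c with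
  | zero => rfl
  | succ t ih => exact ((le_edgePalette c).trans (edgePalette_le_nodePalette c)).trans (ih _)

/-- The factor lost in a half-step is at most `D`, hence costs a single power of `D⁻¹`. This
accounts for each `+ 1` in `failureExponent`. -/
lemma mul_inv_pow_succ_le {c D a : ℕ} (h : 4 * c + 1 ≤ D) :
    (4 * (c : ℝ≥0∞) + 1) * ((D : ℝ≥0∞)⁻¹) ^ (a + 1) ≤ ((D : ℝ≥0∞)⁻¹) ^ a := by
  have hD : (4 * (c : ℝ≥0∞) + 1) ≤ D := by exact_mod_cast h
  calc _ ≤ (D : ℝ≥0∞) * ((D : ℝ≥0∞)⁻¹) ^ (a + 1) := by gcongr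
    _ = (D : ℝ≥0∞) * (D : ℝ≥0∞)⁻¹ * ((D : ℝ≥0∞)⁻¹) ^ a := by ring
    _ = _ := by
      rw [ENNReal.mul_inv_cancel (by simp; omega) (by simp), one_mul]

/-- Node colorings with radius `t` and few colors fail with a probability that is bounded below. -/
theorem inv_pow_lt_measure_nodeFailure (t : ℕ) {C : Type} [Fintype C]
    {f : (FreeGroup Bool → Ω) → C} (hf : ∀ a, MeasurableSet {ω | f ω = a})
    (df : DependsOn f (treeBall 1 t)) {D : ℕ} (hD : 4 * nodePalette^[t] (Fintype.card C) + 1 ≤ D) :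
    ((D : ℝ≥0∞)⁻¹) ^ failureExponent t < iidLaw _ ν (nodeFailure f) := by
  have hD0 : (D : ℝ≥0∞) ≠ 0 := by
    have : D ≠ 0 := by omega
    exact_mod_cast this
  have hδ0 : ∀ a : ℕ, ((D : ℝ≥0∞)⁻¹) ^ a ≠ 0 := fun a => pow_ne_zero _ (by simp)
  have hδ1 : ∀ a : ℕ, ((D : ℝ≥0∞)⁻¹) ^ a ≠ ∞ := fun a => ENNReal.pow_ne_top (by simpa using hD0)
  induction t generalizing C with
  | zero =>
    refine lt_of_lt_of_le ?_ (inv_card_pow_le_measure_nodeFailure hf df)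
    refine (ENNReal.pow_right_strictMono (n := 5) (by norm_num)) ?_
    rw [ENNReal.inv_lt_inv]
    have : Fintype.card C < D := by
      simp only [Function.iterate_zero, id] at hD
      omega
    exact_mod_cast this
  | succ t ih =>
    by_contra! hle
    have hcD : 4 * Fintype.card C + 1 ≤ D := by
      have := le_iterate_nodePalette (t + 1) (Fintype.card C)
      omega
    rw [Function.iterate_succ_apply] at hD
    have heD : 4 * edgePalette (Fintype.card C) + 1 ≤ D := by
      have h1 := le_iterate_nodePalette t (nodePalette (Fintype.card C))
      have h2 := edgePalette_le_nodePalette (Fintype.card C)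
      omega
    -- With `e = failureExponent t`, the first half-step uses `δ = D⁻¹ ^ (5 * (e + 1) + 1)` and
    -- leaves failure at most `(D⁻¹ ^ (e + 1)) ^ 5`; the second uses `δ = D⁻¹ ^ (e + 1)` and leaves
    -- `D⁻¹ ^ e`.
    obtain ⟨g, hg, dg, hopp, hgfail⟩ := exists_edge_coloring_of_node_coloring hf df
      (hδ0 (5 * (failureExponent t + 1) + 1)) (hδ1 _) (by
        rw [← pow_mul, mul_comm]
        exact hle)
    have hK : Fintype.card (Set C × Set C) = edgePalette (Fintype.card C) := by
      simp [edgePalette]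
    obtain ⟨f', hf', df', hfail⟩ := exists_node_coloring_of_edge_coloring hg dg hopp
      (hδ0 (failureExponent t + 1)) (hδ1 _) (by
        rw [← pow_mul, mul_comm]
        exact hgfail.trans (mul_inv_pow_succ_le hcD))
    have hN : Fintype.card (Dir → Set (Set C × Set C)) = nodePalette (Fintype.card C) := by
      rw [Fintype.card_fun, Fintype.card_set, hK, nodePalette]
      rfl
    refine absurd (ih hf' df' (by rw [hN]; exact hD)) (not_lt.2 (hfail.trans ?_))
    rw [hK]
    exact mul_inv_pow_succ_le heD

end RoundElimination

/-! ### Towers of twos, the iterated logarithm and growth of the constants. -/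

section Tower

/-- The tower of `k` twos. -/
def twoTower : ℕ → ℕ
  | 0 => 1
  | k + 1 => 2 ^ twoTower k

lemma lt_twoTower (k : ℕ) : k < twoTower k := by
  induction k with
  | zero => simp [twoTower]
  | succ k ih =>
    have := (twoTower k).lt_two_pow_self
    simp only [twoTower]
    omega

/-- Assuming the bound for every `j ≤ k` keeps all arguments above `1`, where `Real.logb` is a
genuine inverse of exponentiation. -/
lemma twoTower_lt_of_one_lt_iterate {k : ℕ} {x : ℝ} (h : ∀ j ≤ k, 1 < (Real.logb 2)^[j] x) :
    (twoTower k : ℝ) < x := by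
  induction k generalizing x with
  | zero => simpa [twoTower] using h 0 le_rfl
  | succ k ih =>
    have h0 : 1 < x := h 0 (Nat.zero_le _)
    have h1 : (twoTower k : ℝ) < Real.logb 2 x := ih fun j hj => by
      rw [← Function.iterate_succ_apply]
      exact h (j + 1) (by omega)
    rw [Real.lt_logb_iff_rpow_lt one_lt_two (by linarith), Real.rpow_natCast] at h1
    simpa [twoTower] using h1

lemma twoTower_lt_of_lt_logStar {n k : ℕ} (h : k < logStar n) : twoTower k < n := by
  have : (twoTower k : ℝ) < n := twoTower_lt_of_one_lt_iterate fun j hj => by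
    by_contra! hc
    exact Nat.notMem_of_lt_sInf (lt_of_le_of_lt hj h) hc
  exact_mod_cast this

lemma exists_iterate_logb_le_one (k : ℕ) (x : ℝ) (h : x ≤ twoTower k) :
    ∃ j, (Real.logb 2)^[j] x ≤ 1 := by
  induction k generalizing x with
  | zero => exact ⟨0, by simpa [twoTower] using h⟩
  | succ k ih =>
    by_cases h0 : x ≤ 1
    · exact ⟨0, h0⟩
    · obtain ⟨j, hj⟩ := ih (Real.logb 2 x) (by
        rw [Real.logb_le_iff_le_rpow one_lt_two (by linarith), Real.rpow_natCast]
        simpa [twoTower] using h)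
      exact ⟨j + 1, by simpa using hj⟩

lemma one_lt_iterate_logb {k j : ℕ} {x : ℝ} (h : (twoTower k : ℝ) < x) (hj : j ≤ k) :
    1 < (Real.logb 2)^[j] x := by
  induction k generalizing x j with
  | zero =>
    obtain rfl : j = 0 := by omega
    simpa [twoTower] using h
  | succ k ih =>
    have hx : 0 < x := lt_of_le_of_lt (Nat.cast_nonneg _) h
    cases j with
    | zero =>
      have h1 : (1 : ℝ) ≤ twoTower (k + 1) := by
        exact_mod_cast (Nat.zero_le _).trans_lt (lt_twoTower (k + 1))
      exact h1.trans_lt h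
    | succ j =>
      rw [Function.iterate_succ_apply]
      refine ih ?_ (by omega)
      rw [Real.lt_logb_iff_rpow_lt one_lt_two hx, Real.rpow_natCast]
      simpa [twoTower] using h

lemma lt_logStar_of_twoTower_lt {n k : ℕ} (h : twoTower k < n) : k < logStar n := by
  by_contra! hc
  -- Nonemptiness guarantees that the infimum is attained and is not the default value `0` of the
  -- empty set.
  have hne : {k : ℕ | (Real.logb 2)^[k] (n : ℝ) ≤ 1}.Nonempty :=
    exists_iterate_logb_le_one n n (by exact_mod_cast (lt_twoTower n).le)
  have h1 : (Real.logb 2)^[logStar n] (n : ℝ) ≤ 1 := Nat.sInf_mem hne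
  exact absurd h1 (not_le.2 (one_lt_iterate_logb (by exact_mod_cast h) hc))

lemma exists_forall_lt_logStar (k : ℕ) : ∃ n₀, ∀ n, n₀ ≤ n → k < logStar n :=
  ⟨twoTower k + 1, fun _ h => lt_logStar_of_twoTower_lt h⟩

lemma nodePalette_eq (c : ℕ) : nodePalette c = 2 ^ 2 ^ (2 * c + 2) := by
  rw [nodePalette, edgePalette, ← pow_mul]
  congr 1
  ring

/-- A round of elimination is a double exponential, so two tower levels. The form `2 * c + 3`
survives induction: it exceeds the exponent `2 * c + 2` in `nodePalette_eq` by one, which squares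
the palette, and `2 * y + 3 ≤ y ^ 2` for `y ≥ 4`. -/
lemma two_mul_iterate_nodePalette_le {c j : ℕ} (h : 2 * c + 3 ≤ twoTower j) (t : ℕ) :
    2 * nodePalette^[t] c + 3 ≤ twoTower (2 * t + j) := by
  induction t with
  | zero => simpa using h
  | succ t ih =>
    rw [Function.iterate_succ_apply', nodePalette_eq]
    set d := nodePalette^[t] c
    rw [show 2 * (t + 1) + j = 2 * t + j + 2 by ring]
    simp only [twoTower]
    refine le_trans ?_ (Nat.pow_le_pow_right two_pos (Nat.pow_le_pow_right two_pos ih))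
    rw [show 2 * d + 3 = (2 * d + 2) + 1 by ring, pow_succ 2 (2 * d + 2), pow_mul]
    have h1 : 4 ≤ 2 ^ 2 ^ (2 * d + 2) := by
      calc 4 = 2 ^ 2 := by norm_num
        _ ≤ 2 ^ 2 ^ (2 * d + 2) := by
          refine Nat.pow_le_pow_right two_pos ?_
          exact (by omega : 2 ≤ 2 * d + 2).trans (Nat.lt_two_pow_self).le
    nlinarith

lemma failureExponent_le (t : ℕ) : 5 ≤ failureExponent t ∧ failureExponent t ≤ 2 ^ (5 * t + 3) := by
  induction t with
  | zero => simp [failureExponent]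
  | succ t ih =>
    simp only [failureExponent]
    rw [show 5 * (t + 1) + 3 = (5 * t + 3) + 5 by ring, pow_add]
    omega

/-- The number of disjoint neighborhoods that the lower bound needs. -/
def sampleSize (t : ℕ) : ℕ := 3 * (4 * nodePalette^[t] 2 + 1) ^ failureExponent t

lemma five_pow_lt_of_twoTower_lt {n t : ℕ} (h : twoTower (2 * t + 7) < n) :
    5 ^ ((2 * t + 3) * sampleSize t + t + 4) < n := by
  refine lt_of_le_of_lt ?_ h
  have hc : 2 * nodePalette^[t] 2 + 3 ≤ twoTower (2 * t + 3) :=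
    two_mul_iterate_nodePalette_le (by decide) t
  have hX : 2 * t + 3 < twoTower (2 * t + 3) := lt_twoTower _
  simp only [twoTower] at hc hX ⊢
  -- `X` is `twoTower (2 * t + 3)`, which bounds both the palette and `t`. The remaining four tower
  -- levels absorb the failure exponent, the number of balls and the volume of the tree.
  set X := 2 ^ 2 ^ 2 ^ twoTower (2 * t) with hXdef
  have h4 : 4 * X ≤ 2 ^ X := by
    obtain ⟨k, hk⟩ : ∃ k, X = k + 4 := ⟨X - 4, by omega⟩
    rw [hk, pow_add]
    have := k.lt_two_pow_self
    omega
  have hs : sampleSize t ≤ 3 * 2 ^ (X * 2 ^ (5 * t + 3)) := by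
    unfold sampleSize
    refine Nat.mul_le_mul_left 3 ?_
    rw [pow_mul]
    calc _ ≤ (2 ^ X) ^ failureExponent t := Nat.pow_le_pow_left (by omega) _
      _ ≤ _ := Nat.pow_le_pow_right (by positivity) (failureExponent_le t).2
  have hs1 : 1 ≤ sampleSize t := by
    unfold sampleSize
    have : 0 < (4 * nodePalette^[t] 2 + 1) ^ failureExponent t := by positivity
    omega
  -- The factor `3` pays for `5 ≤ 2 ^ 3`.
  have hexp : 3 * ((2 * t + 3) * sampleSize t + t + 4) ≤ 2 ^ 2 ^ 2 ^ X := by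
    calc _ ≤ (9 * t + 21) * sampleSize t := by nlinarith
      _ ≤ (9 * t + 21) * (3 * 2 ^ (X * 2 ^ (5 * t + 3))) := by gcongr
      _ = (3 * (9 * t + 21)) * 2 ^ (X * 2 ^ (5 * t + 3)) := by ring
      _ ≤ 2 ^ (2 * X) * 2 ^ (X * 2 ^ (5 * t + 3)) := by
        gcongr
        rw [two_mul, pow_add]
        nlinarith
      _ = 2 ^ (2 * X + X * 2 ^ (5 * t + 3)) := (pow_add 2 _ _).symm
      _ ≤ _ := by
        refine Nat.pow_le_pow_right two_pos ?_
        calc 2 * X + X * 2 ^ (5 * t + 3) ≤ X * 2 ^ (5 * t + 4) := by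
              rw [pow_succ 2 (5 * t + 3)]
              have : 2 ≤ 2 ^ (5 * t + 3) := Nat.le_self_pow (by omega) 2
              nlinarith
          _ ≤ 2 ^ X * 2 ^ (5 * t + 4) := by
              gcongr
              exact X.lt_two_pow_self.le
          _ = 2 ^ (X + (5 * t + 4)) := (pow_add 2 _ _).symm
          _ ≤ _ := Nat.pow_le_pow_right two_pos (by omega)
  calc 5 ^ ((2 * t + 3) * sampleSize t + t + 4) ≤ (2 ^ 3) ^ ((2 * t + 3) * sampleSize t + t + 4) :=
        Nat.pow_le_pow_left (by norm_num) _
    _ = 2 ^ (3 * ((2 * t + 3) * sampleSize t + t + 4)) := by rw [pow_mul]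
    _ ≤ _ := Nat.pow_le_pow_right two_pos hexp

end Tower

/-! ### Finite oriented trees cut out of the infinite tree. -/

section FiniteTree

/-- A finite set of nodes of the 4-regular tree that contains `1` and is closed under moving
towards `1`. -/
structure IsPrefixClosed (I : Finset (FreeGroup Bool)) : Prop where
  one_mem : 1 ∈ I
  mul_gen_mem : ∀ h ∈ I, ∀ x : Dir, (h * x.gen).norm < h.norm → h * x.gen ∈ I

/-- The nodes in `I` and their neighbors. -/
def treeNodes (I : Finset (FreeGroup Bool)) : Finset (FreeGroup Bool) :=
  I ∪ (I ×ˢ Finset.univ).image fun p : FreeGroup Bool × Dir => p.1 * p.2.gen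

variable {I : Finset (FreeGroup Bool)}

lemma mem_treeNodes {v : FreeGroup Bool} :
    v ∈ treeNodes I ↔ v ∈ I ∨ ∃ h ∈ I, ∃ x : Dir, h * x.gen = v := by
  simp [treeNodes]

@[simp] lemma mul_gen_mul_gen_opp (h : FreeGroup Bool) (x : Dir) : h * x.gen * x.opp.gen = h := by
  simp [mul_assoc]

lemma mul_gen_mem_treeNodes {v : FreeGroup Bool} (hv : v ∈ I) (x : Dir) :
    v * x.gen ∈ treeNodes I :=
  mem_treeNodes.2 (Or.inr ⟨v, hv, x, rfl⟩)

namespace IsPrefixClosed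

variable (hI : IsPrefixClosed I)
include hI

/-- A node whose distance from `1` is larger than that of its neighbor in `I`. -/
lemma norm_mul_gen_of_notMem {h : FreeGroup Bool} (hh : h ∈ I) {x : Dir} (hx : h * x.gen ∉ I) :
    (h * x.gen).norm = h.norm + 1 := by
  rcases norm_mul_gen h x with h1 | h1
  · exact h1
  · exact absurd (hI.mul_gen_mem h hh x (by omega)) hx

/-- These nodes are the leaves. Any second neighbor in the tree would lie farther out and outside
`I`, so it would be attached to `I` through its parent; but that parent is `v`, which is not in `I`.
-/
lemma existsUnique_neighbor {v : FreeGroup Bool} (hv : v ∈ treeNodes I) (hvI : v ∉ I) :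
    ∃ x : Dir, v * x.gen ∈ I ∧ ∀ y : Dir, v * y.gen ∈ treeNodes I → y = x := by
  obtain ⟨h, hh, x, rfl⟩ := (mem_treeNodes.1 hv).resolve_left hvI
  have hn := hI.norm_mul_gen_of_notMem hh hvI
  refine ⟨x.opp, by simpa using hh, fun y hy => ?_⟩
  by_contra hyx
  have hup : (h * x.gen * y.gen).norm = (h * x.gen).norm + 1 := by
    rcases norm_mul_gen (h * x.gen) y with h1 | h1
    · exact h1
    · refine absurd (eq_of_norm_mul_gen_lt (x := y) (y := x.opp) (h := h * x.gen) (by omega) ?_) hyx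
      rw [mul_gen_mul_gen_opp]
      omega
  have hnot : h * x.gen * y.gen ∉ I := fun hm => by
    have := hI.mul_gen_mem _ hm y.opp (by rw [mul_gen_mul_gen_opp]; omega)
    rw [mul_gen_mul_gen_opp] at this
    exact hvI this
  obtain ⟨h', hh', z, hz⟩ := (mem_treeNodes.1 hy).resolve_left hnot
  have hn' := hI.norm_mul_gen_of_notMem hh' (x := z) (by rwa [hz])
  have hh'' : h' = h * x.gen * y.gen * z.opp.gen := by rw [← hz, mul_gen_mul_gen_opp]
  have : y.opp = z.opp := by
    refine eq_of_norm_mul_gen_lt (h := h * x.gen * y.gen) ?_ ?_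
    · rw [mul_gen_mul_gen_opp]
      omega
    · rw [← hh'', ← hz]
      omega
  rw [← this, mul_gen_mul_gen_opp] at hh''
  exact hvI (hh'' ▸ hh')

lemma mul_gen_mem_treeNodes_of_norm_lt {v : FreeGroup Bool} (hv : v ∈ treeNodes I) {x : Dir}
    (hx : (v * x.gen).norm < v.norm) : v * x.gen ∈ I := by
  by_cases hvI : v ∈ I
  · exact hI.mul_gen_mem v hvI x hx
  · obtain ⟨h, hh, y, rfl⟩ := (mem_treeNodes.1 hv).resolve_left hvI
    have hn := hI.norm_mul_gen_of_notMem hh hvI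
    have : x = y.opp := eq_of_norm_mul_gen_lt hx (by rw [mul_gen_mul_gen_opp]; omega)
    rw [this, mul_gen_mul_gen_opp]
    exact hh

/-- Nodes other than `1` correspond to pairs of a parent in `I` and an outward direction; there are
four such directions at `1` and three elsewhere. -/
lemma card_treeNodes : (treeNodes I).card = 3 * I.card + 2 := by
  classical
  let P := (I ×ˢ (Finset.univ : Finset Dir)).filter fun p => (p.1 * p.2.gen).norm = p.1.norm + 1
  have h1 : treeNodes I = insert 1 (P.image fun p => p.1 * p.2.gen) := by
    ext v
    rw [Finset.mem_insert, Finset.mem_image]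
    constructor
    · intro hv
      by_cases hv1 : v = 1
      · exact Or.inl hv1
      · obtain ⟨x, hx⟩ := exists_norm_mul_gen_lt hv1
        refine Or.inr ⟨(v * x.gen, x.opp), ?_, by simp⟩
        have := norm_mul_gen v x
        simp only [P, Finset.mem_filter, Finset.mem_product, Finset.mem_univ, and_true,
          mul_gen_mul_gen_opp]
        exact ⟨hI.mul_gen_mem_treeNodes_of_norm_lt hv hx, by omega⟩
    · rintro (rfl | ⟨p, hp, rfl⟩)
      · exact mem_treeNodes.2 (Or.inl hI.one_mem)
      · simp only [P, Finset.mem_filter, Finset.mem_product] at hp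
        exact mul_gen_mem_treeNodes hp.1.1 _
  have h2 : (P.image fun p => p.1 * p.2.gen).card = P.card := by
    refine Finset.card_image_of_injOn ?_
    rintro ⟨h, x⟩ hp ⟨h', x'⟩ hp' heq
    simp only [P, Finset.coe_filter, Set.mem_ofPred_eq] at hp hp' heq
    have : x.opp = x'.opp := by
      refine eq_of_norm_mul_gen_lt (h := h * x.gen) ?_ ?_
      · rw [mul_gen_mul_gen_opp]; omega
      · rw [heq, mul_gen_mul_gen_opp]; omega
    have hx : x = x' := by rw [← x.opp_opp, this, x'.opp_opp]
    subst hx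
    rw [mul_right_cancel heq]
  have h3 : (1 : FreeGroup Bool) ∉ P.image fun p => p.1 * p.2.gen := by
    rw [Finset.mem_image]
    rintro ⟨p, hp, hp1⟩
    simp only [P, Finset.mem_filter] at hp
    rw [hp1, FreeGroup.norm_one] at hp
    omega
  have h4 : P.card = ∑ h ∈ I, if h = 1 then 4 else 3 := by
    rw [Finset.card_filter, Finset.sum_product]
    refine Finset.sum_congr rfl fun h _ => ?_
    rw [← Finset.card_filter]
    split_ifs with hh
    · subst hh
      rw [Finset.filter_true_of_mem fun x _ => by simp [norm_gen]]
      rfl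
    · obtain ⟨y, hy⟩ := exists_norm_mul_gen_lt hh
      have : (Finset.univ.filter fun x : Dir => (h * x.gen).norm = h.norm + 1) =
          Finset.univ.erase y := by
        ext x
        simp only [Finset.mem_filter, Finset.mem_univ, true_and, Finset.mem_erase, and_true]
        constructor
        · rintro hx rfl
          omega
        · intro hxy
          rcases norm_mul_gen h x with h1 | h1
          · exact h1
          · exact absurd (eq_of_norm_mul_gen_lt (by omega) hy) hxy
      rw [this, Finset.card_erase_of_mem (Finset.mem_univ _)]
      rfl
  have h5 : (∑ h ∈ I, if h = 1 then 4 else 3) = 3 * I.card + 1 := by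
    have : ∀ h ∈ I, (if h = 1 then 4 else 3) = 3 + if h = 1 then 1 else 0 := fun h _ => by
      split_ifs <;> rfl
    rw [Finset.sum_congr rfl this, Finset.sum_add_distrib, Finset.sum_ite_eq' I 1]
    simp [hI.one_mem, mul_comm]
  rw [h1, Finset.card_insert_of_notMem h3, h2, h4, h5]

end IsPrefixClosed

/-- The neighbor in the finite tree. -/
def treeNbr (I : Finset (FreeGroup Bool)) (v : treeNodes I) (x : Dir) : Option (treeNodes I) :=
  if h : v.1 * x.gen ∈ treeNodes I then some ⟨v.1 * x.gen, h⟩ else none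

lemma treeNbr_eq_some {u v : treeNodes I} {x : Dir} :
    treeNbr I u x = some v ↔ u.1 * x.gen = v.1 := by
  unfold treeNbr
  split_ifs with h
  · rw [Option.some_inj, ← Subtype.coe_inj]
  · simp only [false_iff]
    exact fun hv => h (hv ▸ v.2)

/-- The graph of the finite tree. -/
def treeGraph (I : Finset (FreeGroup Bool)) : SimpleGraph (treeNodes I) where
  Adj u v := ∃ x : Dir, treeNbr I u x = some v
  symm := ⟨by
    rintro u v ⟨x, hx⟩
    rw [treeNbr_eq_some] at hx
    exact ⟨x.opp, treeNbr_eq_some.2 (by rw [← hx, mul_gen_mul_gen_opp])⟩⟩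
  loopless := ⟨by
    rintro u ⟨x, hx⟩
    rw [treeNbr_eq_some, mul_eq_left] at hx
    have := norm_gen x
    simp [hx] at this⟩

lemma treeGraph_adj {u v : treeNodes I} : (treeGraph I).Adj u v ↔ ∃ x : Dir, u.1 * x.gen = v.1 :=
  exists_congr fun _ => treeNbr_eq_some

namespace IsPrefixClosed

variable (hI : IsPrefixClosed I)
include hI

lemma treeGraph_connected : (treeGraph I).Connected := by
  rw [SimpleGraph.connected_iff_exists_forall_reachable]
  refine ⟨⟨1, mem_treeNodes.2 (Or.inl hI.one_mem)⟩, ?_⟩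
  have : ∀ n : ℕ, ∀ v : treeNodes I, v.1.norm = n →
      (treeGraph I).Reachable ⟨1, mem_treeNodes.2 (Or.inl hI.one_mem)⟩ v := by
    intro n
    induction n using Nat.strong_induction_on with
    | _ n ih =>
      rintro ⟨v, hv⟩ hn
      by_cases h1 : v = 1
      · subst h1
        rfl
      · obtain ⟨x, hx⟩ := exists_norm_mul_gen_lt h1
        have hm : v * x.gen ∈ treeNodes I :=
          mem_treeNodes.2 (Or.inl (hI.mul_gen_mem_treeNodes_of_norm_lt hv hx))
        refine (ih _ (hn ▸ hx) ⟨_, hm⟩ rfl).trans (SimpleGraph.Adj.reachable ?_)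
        exact treeGraph_adj.2 ⟨x.opp, mul_gen_mul_gen_opp _ _⟩
  exact fun v => this _ v rfl

/-- Every edge joins some node other than `1` to its parent, so a connected graph has at most one
edge fewer than it has nodes. -/
lemma treeGraph_isTree : (treeGraph I).IsTree := by
  classical
  rw [SimpleGraph.isTree_iff_connected_and_card]
  refine ⟨hI.treeGraph_connected, le_antisymm ?_ hI.treeGraph_connected.card_vert_le_card_edgeSet_add_one⟩
  let one : treeNodes I := ⟨1, mem_treeNodes.2 (Or.inl hI.one_mem)⟩
  have hpar : ∀ v : {v : treeNodes I // v ≠ one}, ∃ u, (treeGraph I).Adj v.1 u ∧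
      u.1.norm < v.1.1.norm := by
    rintro ⟨⟨v, hv⟩, hne⟩
    obtain ⟨x, hx⟩ := exists_norm_mul_gen_lt (h := v) fun h => hne (Subtype.ext h)
    exact ⟨⟨v * x.gen, mem_treeNodes.2 (Or.inl (hI.mul_gen_mem_treeNodes_of_norm_lt hv hx))⟩,
      treeGraph_adj.2 ⟨x, rfl⟩, hx⟩
  choose par hpar hlt using hpar
  have hsurj : Function.Surjective fun v : {v : treeNodes I // v ≠ one} =>
      (⟨s(v.1, par v), hpar v⟩ : (treeGraph I).edgeSet) := by
    have key : ∀ u v : treeNodes I, (treeGraph I).Adj u v → v.1.norm < u.1.norm →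
        ∃ w : {v : treeNodes I // v ≠ one}, s(w.1, par w) = s(u, v) := by
      intro u v huv h
      have hu : u ≠ one := by
        rintro rfl
        simp [one] at h
      refine ⟨⟨u, hu⟩, ?_⟩
      obtain ⟨x, hx⟩ := treeGraph_adj.1 huv
      obtain ⟨y, hy⟩ := treeGraph_adj.1 (hpar ⟨u, hu⟩)
      have hlt' := hlt ⟨u, hu⟩
      rw [← hx] at h
      rw [← hy] at hlt'
      have hxy := eq_of_norm_mul_gen_lt h hlt'
      have : par ⟨u, hu⟩ = v := Subtype.ext (by rw [← hy, ← hx, hxy])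
      rw [this]
    rintro ⟨e, he⟩
    induction e using Sym2.ind with
    | _ u v =>
      have huv : (treeGraph I).Adj u v := he
      obtain ⟨x, hx⟩ := treeGraph_adj.1 huv
      rcases norm_mul_gen u.1 x with h | h <;> rw [hx] at h
      · obtain ⟨w, hw⟩ := key v u huv.symm (by omega)
        exact ⟨w, Subtype.ext (hw.trans Sym2.eq_swap)⟩
      · obtain ⟨w, hw⟩ := key u v huv (by omega)
        exact ⟨w, Subtype.ext hw⟩
  have h1 : Nat.card (treeGraph I).edgeSet ≤ _ := Nat.card_le_card_of_surjective _ hsurj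
  have h2 : Nat.card {v : treeNodes I // v ≠ one} + 1 = Nat.card (treeNodes I) := by
    rw [Nat.card_eq_fintype_card, Nat.card_eq_fintype_card, Fintype.card_subtype_compl,
      Fintype.card_subtype_eq]
    have : 0 < Fintype.card (treeNodes I) := Fintype.card_pos_iff.2 ⟨one⟩
    omega
  omega

lemma ncard_neighborSet (v : treeNodes I) :
    ((treeGraph I).neighborSet v).ncard = 4 ∨ ((treeGraph I).neighborSet v).ncard = 1 := by
  by_cases hv : v.1 ∈ I
  · left
    let φ : Dir → treeNodes I := fun x => ⟨v.1 * x.gen, mul_gen_mem_treeNodes hv x⟩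
    have hφ : Function.Injective φ := fun x y h =>
      Dir.gen_injective (mul_left_cancel (congrArg Subtype.val h))
    have : (treeGraph I).neighborSet v = φ '' Set.univ := by
      ext u
      rw [SimpleGraph.mem_neighborSet, treeGraph_adj]
      simp [φ, Subtype.ext_iff]
    rw [this, Set.ncard_image_of_injective _ hφ, Set.ncard_univ, Nat.card_eq_fintype_card]
    rfl
  · right
    obtain ⟨x, hx, hu⟩ := hI.existsUnique_neighbor v.2 hv
    rw [Set.ncard_eq_one]
    refine ⟨⟨v.1 * x.gen, mem_treeNodes.2 (Or.inl hx)⟩, ?_⟩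
    ext u
    rw [SimpleGraph.mem_neighborSet, treeGraph_adj, Set.mem_singleton_iff, Subtype.ext_iff]
    constructor
    · rintro ⟨y, hy⟩
      rw [← hy, hu y (hy ▸ u.2)]
    · intro h
      exact ⟨x, h.symm⟩

/-- The consistently oriented finite tree with interior `I`. -/
def orientedTree : OrientedTree (treeNodes I) where
  graph := treeGraph I
  isTree := hI.treeGraph_isTree
  regular := hI.ncard_neighborSet
  nbr := treeNbr I
  adj_iff _ _ := Iff.rfl
  label_unique u v x y hx hy := by
    rw [treeNbr_eq_some] at hx hy
    exact Dir.gen_injective (mul_left_cancel (hx.trans hy.symm))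
  nbr_opp u v x h := by
    rw [treeNbr_eq_some] at h ⊢
    rw [← h, mul_gen_mul_gen_opp]

end IsPrefixClosed

/-- The element of the free group addressed by a sequence of directions. -/
def wordProd (w : List Dir) : FreeGroup Bool := (w.map Dir.gen).prod

lemma norm_wordProd_le (w : List Dir) : (wordProd w).norm ≤ w.length := by
  induction w with
  | nil => simp [wordProd]
  | cons x w ih =>
    have := norm_gen_mul x (wordProd w)
    simp only [wordProd, List.map_cons, List.prod_cons, List.length_cons] at *
    omega

/-- A walk of length at most `t` cannot leave a radius-`t` ball of interior nodes, so it never meets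
a missing edge. -/
lemma IsPrefixClosed.follow_eq (hI : IsPrefixClosed I) {t : ℕ} {v : treeNodes I}
    (hv : treeBall v.1 t ⊆ I) (w : List Dir) (hw : w.length ≤ t) :
    ∃ u : treeNodes I, hI.orientedTree.follow v w = some u ∧ u.1 = v.1 * wordProd w ∧ u.1 ∈ I := by
  induction w generalizing v t with
  | nil =>
    exact ⟨v, rfl, by simp [wordProd], hv (by simp [treeBall])⟩
  | cons x w ih =>
    have hvI : v.1 ∈ I := hv (by simp [treeBall])
    obtain ⟨s, rfl⟩ : ∃ s, t = s + 1 := ⟨t - 1, by simp at hw; omega⟩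
    let v' : treeNodes I := ⟨v.1 * x.gen, mul_gen_mem_treeNodes hvI x⟩
    have hnbr : hI.orientedTree.nbr v x = some v' := treeNbr_eq_some.2 rfl
    have hsub : treeBall v'.1 s ⊆ I := by
      intro h hh
      refine hv ?_
      have h1 : x.gen * (x.opp.gen * (v.1⁻¹ * h)) ∈ treeBall 1 (s + 1) := by
        refine treeBall_gen_subset (x := x) (gen_mul_mem_treeBall.2 ?_)
        rw [mem_treeBall_one]
        simpa [treeBall, v', mul_assoc, Dir.gen_opp] using hh
      rw [← mul_assoc, Dir.gen_mul_gen_opp, one_mul, mem_treeBall_one] at h1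
      exact h1
    obtain ⟨u, hu, hu', huI⟩ := ih hsub (by simpa using hw)
    refine ⟨u, ?_, ?_, huI⟩
    · rw [OrientedTree.follow, hnbr]
      exact hu
    · rw [hu']
      simp [v', wordProd, mul_assoc]

end FiniteTree

/-! ### Interiors of prescribed size and disjoint balls along a line. -/

section Ball

/-- The ball of radius `s` around `1` as a finite set. -/
def ballFinset : ℕ → Finset (FreeGroup Bool)
  | 0 => {1}
  | s + 1 => treeNodes (ballFinset s)

lemma mem_ballFinset {s : ℕ} {h : FreeGroup Bool} : h ∈ ballFinset s ↔ h.norm ≤ s := by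
  induction s generalizing h with
  | zero => simp [ballFinset]
  | succ s ih =>
    simp only [ballFinset, mem_treeNodes, ih]
    constructor
    · rintro (h1 | ⟨k, hk, x, rfl⟩)
      · omega
      · have := norm_mul_gen k x
        omega
    · intro hn
      by_cases h1 : h = 1
      · left
        simp [h1]
      · obtain ⟨x, hx⟩ := exists_norm_mul_gen_lt h1
        exact Or.inr ⟨h * x.gen, by omega, x.opp, mul_gen_mul_gen_opp _ _⟩

lemma card_ballFinset_le (s : ℕ) : (ballFinset s).card ≤ 5 ^ s := by
  induction s with
  | zero => simp [ballFinset]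
  | succ s ih =>
    have h1 : (treeNodes (ballFinset s)).card ≤ _ := Finset.card_union_le _ _
    have h2 := (Finset.card_image_le (s := ballFinset s ×ˢ Finset.univ)
      (f := fun p : FreeGroup Bool × Dir => p.1 * p.2.gen))
    rw [Finset.card_product, show (Finset.univ : Finset Dir).card = 4 from rfl] at h2
    rw [ballFinset, pow_succ]
    omega

lemma ballFinset_mono {r s : ℕ} (h : r ≤ s) : ballFinset r ⊆ ballFinset s := fun _ hg =>
  mem_ballFinset.2 ((mem_ballFinset.1 hg).trans h)

lemma lt_card_ballFinset (s : ℕ) : s < (ballFinset s).card := by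
  have : ((Finset.range (s + 1)).image fun i => FreeGroup.of true ^ i) ⊆ ballFinset s := by
    intro g hg
    obtain ⟨i, hi, rfl⟩ := Finset.mem_image.1 hg
    rw [mem_ballFinset, FreeGroup.norm_of_pow]
    have := Finset.mem_range.1 hi
    omega
  have h := Finset.card_le_card this
  rw [Finset.card_image_of_injective, Finset.card_range] at h
  · exact h
  · intro i j hij
    simpa using congrArg FreeGroup.norm hij

/-- Any set between two consecutive balls is closed under moving towards `1`, so every sufficiently
large cardinality occurs. This reaches every large `n` congruent to `2` modulo `3`. -/
lemma exists_isPrefixClosed {s k : ℕ} (h : 5 ^ s ≤ k) :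
    ∃ I : Finset (FreeGroup Bool), IsPrefixClosed I ∧ ballFinset s ⊆ I ∧ I.card = k := by
  classical
  have hex : ∃ r, k < (ballFinset r).card := ⟨k, lt_card_ballFinset k⟩
  have hlt : s < Nat.find hex := by
    by_contra! hc
    have h1 := Nat.find_spec hex
    have h2 := Finset.card_le_card (ballFinset_mono hc)
    have h3 := card_ballFinset_le s
    omega
  obtain ⟨r, hr⟩ : ∃ r, Nat.find hex = r + 1 := ⟨Nat.find hex - 1, by omega⟩
  have hle : (ballFinset r).card ≤ k := not_lt.1 (Nat.find_min hex (by omega))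
  have hge : k ≤ (ballFinset (r + 1)).card := by
    rw [← hr]
    exact (Nat.find_spec hex).le
  obtain ⟨I, h1, h2, h3⟩ :=
    Finset.exists_subsuperset_card_eq (ballFinset_mono r.le_succ) hle hge
  refine ⟨I, ⟨h1 (mem_ballFinset.2 (by simp)), fun _ hg x hx => h1 (mem_ballFinset.2 ?_)⟩,
    (ballFinset_mono (by omega)).trans h1, h3⟩
  have := mem_ballFinset.1 (h2 hg)
  omega

/-- Points on a line in the tree. -/
def lineCenter (t i : ℕ) : FreeGroup Bool := FreeGroup.of true ^ ((2 * t + 1) * i)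

/-- Distinct centers are at distance at least `2 * t + 1`, as powers of a generator do not cancel.
-/
lemma disjoint_treeBall_lineCenter {t i j : ℕ} (h : i ≠ j) :
    Disjoint (treeBall (lineCenter t i) t) (treeBall (lineCenter t j) t) := by
  wlog hij : i < j generalizing i j
  · exact (this h.symm (by omega)).symm
  rw [Set.disjoint_left]
  intro g hi hj
  simp only [treeBall, Set.mem_ofPred_eq] at hi hj
  obtain ⟨d, rfl⟩ : ∃ d, j = i + d + 1 := ⟨j - i - 1, by omega⟩
  have h1 := FreeGroup.norm_mul_le ((lineCenter t i)⁻¹ * g) ((lineCenter t (i + d + 1))⁻¹ * g)⁻¹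
  rw [FreeGroup.norm_inv_eq, show (lineCenter t i)⁻¹ * g * ((lineCenter t (i + d + 1))⁻¹ * g)⁻¹ =
    FreeGroup.of true ^ ((2 * t + 1) * (d + 1)) by
      rw [mul_inv_rev, inv_inv, mul_assoc, mul_inv_cancel_left, inv_mul_eq_iff_eq_mul, lineCenter,
        lineCenter, ← pow_add]
      ring_nf, FreeGroup.norm_of_pow] at h1
  nlinarith

lemma treeBall_lineCenter_subset {t i s : ℕ} (h : (2 * t + 1) * i + t ≤ s) :
    treeBall (lineCenter t i) t ⊆ ballFinset s := by
  intro g hg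
  simp only [treeBall, Set.mem_ofPred_eq] at hg
  rw [Finset.mem_coe, mem_ballFinset]
  have h1 := FreeGroup.norm_mul_le (lineCenter t i) ((lineCenter t i)⁻¹ * g)
  rw [mul_inv_cancel_left] at h1
  rw [lineCenter, FreeGroup.norm_of_pow, ← lineCenter] at h1
  omega

end Ball

/-! ### From finite trees with unique identifiers to i.i.d. labels on the infinite tree. -/

section Simulation

variable {n t : ℕ}

/-- A label carries an identifier and a bit sequence in each of two independent copies, so that
identifiers can be read from one and bits from the other. -/
abbrev NodeLabel (n : ℕ) : Type := Bool → Fin n × (ℕ → Bool)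

/-- The algorithm at the node `1` of the infinite tree, with random identifiers. -/
def LocalAlgorithm.infiniteRule (A : LocalAlgorithm n t 2) (ω : FreeGroup Bool → NodeLabel n) :
    Fin 2 :=
  A.out (fun w => some ((ω (wordProd w.1) false).1, fun _ => true))
    (fun w => (ω (wordProd w.1) true).2)

instance (t : ℕ) : Finite (Address t) := (List.finite_length_le Dir t).to_subtype

namespace LocalAlgorithm

variable (A : LocalAlgorithm n t 2)

lemma measurableSet_infiniteRule_eq (a : Fin 2) : MeasurableSet {ω | A.infiniteRule ω = a} := by
  have : {ω | A.infiniteRule ω = a} = ⋃ T : Topology n t,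
      (⋂ w : Address t, {ω : FreeGroup Bool → NodeLabel n |
        some ((ω (wordProd w.1) false).1, fun _ => true) = T w}) ∩
      {ω | A.out T (fun w => (ω (wordProd w.1) true).2) = a} := by
    ext ω
    simp only [Set.mem_iUnion, Set.mem_inter_iff, Set.mem_iInter, Set.mem_ofPred_eq]
    constructor
    · intro h
      exact ⟨_, fun _ => rfl, h⟩
    · rintro ⟨T, hT, h⟩
      obtain rfl := funext hT
      exact h
  rw [this]
  refine MeasurableSet.iUnion fun T => MeasurableSet.inter (MeasurableSet.iInter fun w => ?_) ?_
  · have hm : Measurable fun ω : FreeGroup Bool → NodeLabel n => (ω (wordProd w.1) false).1 := by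
      fun_prop
    exact hm (MeasurableSet.of_discrete (s := {i | some (i, fun _ => true) = T w}))
  · have hm : Measurable fun (ω : FreeGroup Bool → NodeLabel n) (w : Address t) =>
        (ω (wordProd w.1) true).2 := by
      fun_prop
    exact ((A.measurable_out T).comp hm) (measurableSet_singleton a)

lemma dependsOn_infiniteRule : DependsOn A.infiniteRule (treeBall 1 t) := by
  intro ω ω' h
  have : ∀ w : Address t, ω (wordProd w.1) = ω' (wordProd w.1) := fun w =>
    h _ (mem_treeBall_one.2 ((norm_wordProd_le _).trans w.2))
  simp only [infiniteRule, this]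

variable {I : Finset (FreeGroup Bool)} (hI : IsPrefixClosed I) (ids : treeNodes I ≃ Fin n)

/-- A view inside the interior misses no node and sees only nodes of degree 4, as the rule on the
infinite tree presupposes. -/
lemma run_eq_infiniteRule {v : treeNodes I} (hv : treeBall v.1 t ⊆ I)
    {ω : FreeGroup Bool → NodeLabel n} {β : treeNodes I → ℕ → Bool}
    (hid : ∀ u : treeNodes I, u.1 ∈ treeBall v.1 t → (ω u.1 false).1 = ids u)
    (hβ : ∀ u : treeNodes I, (ω u.1 true).2 = β u) :
    A.run hI.orientedTree ids β v = A.infiniteRule (shift v.1 ω) := by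
  have hfollow := fun w : Address t => hI.follow_eq hv w.1 w.2
  have hmem : ∀ w : Address t, v.1 * wordProd w.1 ∈ treeBall v.1 t := fun w => by
    simpa [treeBall] using (norm_wordProd_le w.1).trans w.2
  unfold run infiniteRule
  congr 1
  · funext w
    obtain ⟨u, hu, hu', huI⟩ := hfollow w
    simp only [OrientedTree.topologyAt, hu, Option.map_some, shift, ← hu']
    rw [hid u (hu' ▸ hmem w)]
    congr 2
    funext x
    have : hI.orientedTree.nbr u x = some ⟨u.1 * x.gen, mul_gen_mem_treeNodes huI x⟩ :=
      treeNbr_eq_some.2 rfl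
    rw [this]
    rfl
  · funext w
    obtain ⟨u, hu, hu', huI⟩ := hfollow w
    simp only [OrientedTree.bitsAt, hu, Option.map_some, Option.getD_some, shift, ← hu', hβ]

lemma shift_notMem_nodeFailure {v : treeNodes I} (hv : treeBall v.1 (t + 1) ⊆ I)
    {ω : FreeGroup Bool → NodeLabel n} {β : treeNodes I → ℕ → Bool}
    (hid : ∀ u : treeNodes I, u.1 ∈ treeBall v.1 (t + 1) → (ω u.1 false).1 = ids u)
    (hβ : ∀ u : treeNodes I, (ω u.1 true).2 = β u)
    (hw : IsWeakColoring hI.orientedTree.graph (A.run hI.orientedTree ids β)) :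
    shift v.1 ω ∉ nodeFailure A.infiniteRule := by
  intro hf
  obtain ⟨u, hadj, hne⟩ := hw v
  obtain ⟨x, hx⟩ := treeGraph_adj.1 hadj
  have hsub : treeBall u.1 t ⊆ treeBall v.1 (t + 1) := by
    intro h hh
    rw [← hx, ← mul_inv_cancel_left v.1 h] at hh
    rw [← mul_inv_cancel_left v.1 h, ← mul_one v.1]
    simp only [mul_one v.1]
    rw [mul_mem_treeBall] at hh
    have := treeBall_gen_subset hh
    rw [← mul_mem_treeBall (g := v.1), mul_one] at this
    exact this
  refine hne ?_
  rw [A.run_eq_infiniteRule hI ids (hsub.trans hv) (fun u' hu' => hid u' (hsub hu')) hβ,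
    A.run_eq_infiniteRule hI ids ((treeBall_mono t.le_succ).trans hv)
      (fun u' hu' => hid u' (treeBall_mono t.le_succ hu')) hβ, ← hf x, shift_shift, hx]

lemma measurableSet_isWeakColoring_run {V : Type} [Finite V] (G : OrientedTree V)
    (ids : V ≃ Fin n) : MeasurableSet {β | IsWeakColoring G.graph (A.run G ids β)} := by
  have hrun : ∀ v, Measurable fun β => A.run G ids β v := fun v => by
    refine (A.measurable_out _).comp (measurable_pi_lambda _ fun w => ?_)
    simp only [OrientedTree.bitsAt]
    cases G.follow v w.1 with
    | none => exact measurable_const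
    | some u => exact measurable_pi_apply u
  have : {β | IsWeakColoring G.graph (A.run G ids β)} =
      ⋂ v, ⋃ u, {β | G.graph.Adj v u ∧ A.run G ids β u ≠ A.run G ids β v} := by
    ext β
    simp [IsWeakColoring]
  rw [this]
  refine MeasurableSet.iInter fun v => MeasurableSet.iUnion fun u => ?_
  exact (MeasurableSet.const _).inter (measurableSet_eq_fun (hrun u) (hrun v)).compl

end LocalAlgorithm

instance : IsProbabilityMeasure bitSequenceLaw := by
  unfold bitSequenceLaw
  infer_instance

/-- The law of a uniform identifier with an independent bit sequence. -/
noncomputable def singleLabelLaw (n : ℕ) [NeZero n] : Measure (Fin n × (ℕ → Bool)) :=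
  (PMF.uniformOfFintype (Fin n)).toMeasure.prod bitSequenceLaw

instance [NeZero n] : IsProbabilityMeasure (singleLabelLaw n) := by
  unfold singleLabelLaw
  infer_instance

/-- The law of a node label. -/
noncomputable abbrev nodeLabelLaw (n : ℕ) [NeZero n] : Measure (NodeLabel n) :=
  iidLaw Bool (singleLabelLaw n)

variable [NeZero n]

lemma measure_id_eq (g : FreeGroup Bool) (a : Fin n) :
    iidLaw (FreeGroup Bool) (nodeLabelLaw n) {ω | (ω g false).1 = a} = (n : ℝ≥0∞)⁻¹ := by
  have h1 : MeasurePreserving (fun ω : FreeGroup Bool → NodeLabel n => (ω g false).1)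
      (iidLaw (FreeGroup Bool) (nodeLabelLaw n)) (PMF.uniformOfFintype (Fin n)).toMeasure :=
    (measurePreserving_fst (ν := bitSequenceLaw)).comp
      ((measurePreserving_eval_infinitePi (fun _ : Bool => singleLabelLaw n) false).comp
        (measurePreserving_eval_infinitePi (fun _ : FreeGroup Bool => nodeLabelLaw n) g))
  have h2 := h1.measure_preimage (measurableSet_singleton a).nullMeasurableSet
  rw [PMF.toMeasure_apply_singleton _ _ (measurableSet_singleton a), PMF.uniformOfFintype_apply,
    Fintype.card_fin] at h2
  exact h2

lemma measure_id_eq_id_le {g h : FreeGroup Bool} (hgh : g ≠ h) :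
    iidLaw (FreeGroup Bool) (nodeLabelLaw n) {ω | (ω g false).1 = (ω h false).1} ≤
      (n : ℝ≥0∞)⁻¹ := by
  have hm : ∀ (g : FreeGroup Bool) (a : Fin n),
      MeasurableSet {ω : FreeGroup Bool → NodeLabel n | (ω g false).1 = a} := fun g a => by
    have : Measurable fun ω : FreeGroup Bool → NodeLabel n => (ω g false).1 := by fun_prop
    exact this (measurableSet_singleton a)
  have hd : ∀ (g : FreeGroup Bool) (a : Fin n),
      DependsOn (· ∈ {ω : FreeGroup Bool → NodeLabel n | (ω g false).1 = a}) {g} :=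
    fun g a ω ω' h => by simp [h g rfl]
  calc iidLaw (FreeGroup Bool) (nodeLabelLaw n) {ω | (ω g false).1 = (ω h false).1} ≤
      iidLaw (FreeGroup Bool) (nodeLabelLaw n)
        (⋃ a : Fin n, {ω | (ω g false).1 = a} ∩ {ω | (ω h false).1 = a}) :=
        measure_mono fun ω hω => Set.mem_iUnion.2 ⟨(ω h false).1, hω, rfl⟩
    _ ≤ ∑ a : Fin n, iidLaw (FreeGroup Bool) (nodeLabelLaw n)
        ({ω | (ω g false).1 = a} ∩ {ω | (ω h false).1 = a}) := measure_iUnion_fintype_le _ _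
    _ = ∑ _a : Fin n, (n : ℝ≥0∞)⁻¹ * (n : ℝ≥0∞)⁻¹ := by
        refine Finset.sum_congr rfl fun a _ => ?_
        rw [measure_inter_of_dependsOn_disjoint (hm g a) (hm h a) (hd g a) (hd h a)
          (Set.disjoint_singleton.2 hgh), measure_id_eq, measure_id_eq]
    _ = (n : ℝ≥0∞)⁻¹ := by
        rw [Finset.sum_const, Finset.card_univ, Fintype.card_fin, nsmul_eq_mul, ← mul_assoc,
          ENNReal.mul_inv_cancel (by simp [NeZero.ne n]) (by simp), one_mul]

/-- Random identifiers on few nodes are distinct with probability at least one half. -/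
lemma half_le_measure_injOn_id {W : Finset (FreeGroup Bool)} (hW : 2 * W.card ^ 2 ≤ n) :
    1 / 2 ≤ iidLaw (FreeGroup Bool) (nodeLabelLaw n)
      {ω | Set.InjOn (fun g => (ω g false).1) (W : Set (FreeGroup Bool))} := by
  have hn : (n : ℝ≥0∞) ≠ 0 := by simp [NeZero.ne n]
  set E := {ω : FreeGroup Bool → NodeLabel n |
    Set.InjOn (fun g => (ω g false).1) (W : Set (FreeGroup Bool))} with hE
  have hc : iidLaw (FreeGroup Bool) (nodeLabelLaw n) Eᶜ ≤ 1 / 2 := by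
    calc _ ≤ iidLaw (FreeGroup Bool) (nodeLabelLaw n)
          (⋃ p ∈ W.offDiag, {ω | (ω p.1 false).1 = (ω p.2 false).1}) := by
          refine measure_mono fun ω hω => ?_
          simp only [hE, Set.mem_compl_iff, Set.mem_ofPred_eq, Set.InjOn] at hω
          push Not at hω
          obtain ⟨g, hg, h, hh, he, hne⟩ := hω
          simp only [Set.mem_iUnion]
          exact ⟨(g, h), Finset.mem_offDiag.2 ⟨hg, hh, hne⟩, he⟩
      _ ≤ ∑ p ∈ W.offDiag, iidLaw (FreeGroup Bool) (nodeLabelLaw n)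
          {ω | (ω p.1 false).1 = (ω p.2 false).1} := measure_biUnion_finset_le _ _
      _ ≤ ∑ _p ∈ W.offDiag, (n : ℝ≥0∞)⁻¹ :=
          Finset.sum_le_sum fun p hp => measure_id_eq_id_le (Finset.mem_offDiag.1 hp).2.2
      _ = W.offDiag.card * (n : ℝ≥0∞)⁻¹ := by rw [Finset.sum_const, nsmul_eq_mul]
      _ ≤ 1 / 2 := by
          rw [← div_eq_mul_inv, ENNReal.div_le_iff hn (by simp), mul_comm, ← mul_div_assoc, mul_one,
            ENNReal.le_div_iff_mul_le (by simp) (by simp)]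
          have : W.offDiag.card * 2 ≤ n := by
            have : W.offDiag.card ≤ W.card ^ 2 := by
              rw [Finset.offDiag_card, sq]
              omega
            omega
          exact_mod_cast this
  have h1 : 1 ≤ iidLaw (FreeGroup Bool) (nodeLabelLaw n) E +
      iidLaw (FreeGroup Bool) (nodeLabelLaw n) Eᶜ := by
    rw [← measure_univ (μ := iidLaw (FreeGroup Bool) (nodeLabelLaw n)), ← Set.union_compl_self E]
    exact measure_union_le _ _
  have h2 : (1 : ℝ≥0∞) / 2 + 1 / 2 ≤ iidLaw (FreeGroup Bool) (nodeLabelLaw n) E + 1 / 2 := by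
    rw [ENNReal.add_halves]
    exact h1.trans (by gcongr)
  exact (ENNReal.add_le_add_iff_right (by simp)).1 h2

/-- Splitting the labels into coordinates indexed by node and copy makes it possible to condition on
the identifiers alone. -/
lemma measurePreserving_curry_nodeLabel :
    MeasurePreserving (fun (y : FreeGroup Bool × Bool → Fin n × (ℕ → Bool)) g b => y (g, b))
      (iidLaw (FreeGroup Bool × Bool) (singleLabelLaw n))
      (iidLaw (FreeGroup Bool) (nodeLabelLaw n)) :=
  ⟨by fun_prop, Measure.infinitePi_map_curry (fun _ _ => singleLabelLaw n)⟩

lemma measurePreserving_bits (s : Finset (FreeGroup Bool)) :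
    MeasurePreserving
      (fun (y : FreeGroup Bool × Bool → Fin n × (ℕ → Bool)) (u : s) => (y (u.1, true)).2)
      (iidLaw (FreeGroup Bool × Bool) (singleLabelLaw n)) (bitsLaw s) := by
  refine ⟨by fun_prop, ?_⟩
  have hinj : Function.Injective fun u : s => (u.1, true) := fun _ _ h =>
    Subtype.ext (Prod.ext_iff.1 h).1
  have h1 := Measure.map_infinitePi_infinitePi_of_inj (P := fun _ : FreeGroup Bool × Bool =>
    singleLabelLaw n) hinj
  have h2 := Measure.infinitePi_map_pi (fun _ : s => singleLabelLaw n)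
    (f := fun _ => Prod.snd) fun _ => measurable_snd
  rw [← h1, Measure.map_map (by fun_prop) (by fun_prop)] at h2
  have h3 : (singleLabelLaw n).map Prod.snd = bitSequenceLaw :=
    (measurePreserving_snd (μ := (PMF.uniformOfFintype (Fin n)).toMeasure)).map_eq
  rw [h3] at h2
  exact h2.trans (Measure.infinitePi_eq_pi _)

/-- If an algorithm succeeds on the finite tree for all identifiers, then with random identifiers
it succeeds in few neighborhoods of the infinite tree. -/
lemma quarter_le_measure_iInter {A : LocalAlgorithm n t 2} {I : Finset (FreeGroup Bool)}
    (hI : IsPrefixClosed I) (hcard : (treeNodes I).card = n) {m : ℕ} {c : Fin m → FreeGroup Bool}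
    (hA : ∀ ids : treeNodes I ≃ Fin n, 1 / 2 ≤ bitsLaw (treeNodes I)
      {β | IsWeakColoring hI.orientedTree.graph (A.run hI.orientedTree ids β)})
    {W : Finset (FreeGroup Bool)} (hW : 2 * W.card ^ 2 ≤ n)
    (hcI : ∀ i, treeBall (c i) (t + 1) ⊆ I) (hcW : ∀ i, treeBall (c i) (t + 1) ⊆ W) :
    1 / 2 * (1 / 2) ≤ iidLaw (FreeGroup Bool) (nodeLabelLaw n)
      (⋂ i ∈ (Finset.univ : Finset (Fin m)), shift (c i) ⁻¹' (nodeFailure A.infiniteRule)ᶜ) := by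
  classical
  set good := ⋂ i ∈ (Finset.univ : Finset (Fin m)),
    shift (c i) ⁻¹' (nodeFailure A.infiniteRule)ᶜ with hgood
  have mgood : MeasurableSet good := Finset.measurableSet_biInter _ fun i _ =>
    measurable_shift _ (measurableSet_nodeFailure A.measurableSet_infiniteRule_eq).compl
  let κ : (FreeGroup Bool × Bool → Fin n × (ℕ → Bool)) → FreeGroup Bool → NodeLabel n :=
    fun y g b => y (g, b)
  have hκ : MeasurePreserving κ _ _ := measurePreserving_curry_nodeLabel (n := n)
  refine (mul_le_mul_right (half_le_measure_injOn_id hW) (1 / 2)).trans ?_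
  refine (mul_le_mul_right (b := iidLaw (FreeGroup Bool) (nodeLabelLaw n) _)
    (c := iidLaw (FreeGroup Bool × Bool) (singleLabelLaw n) (κ ⁻¹' {ω | Set.InjOn
      (fun g => (ω g false).1) (W : Set (FreeGroup Bool))})) ?_ _).trans ?_
  · refine (hκ.measure_preimage ?_).ge
    have : {ω : FreeGroup Bool → NodeLabel n | Set.InjOn (fun g => (ω g false).1)
        (W : Set (FreeGroup Bool))} = ⋂ g ∈ W, ⋂ h ∈ W,
          {ω | (ω g false).1 = (ω h false).1 → g = h} := by
      ext ω
      simp [Set.InjOn]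
    rw [this]
    refine (Finset.measurableSet_biInter _ fun g _ => Finset.measurableSet_biInter _ fun h _ =>
      ?_).nullMeasurableSet
    exact (measurableSet_eq_fun (by fun_prop) (by fun_prop)).imp (MeasurableSet.const _)
  rw [← hκ.measure_preimage mgood.nullMeasurableSet]
  -- The `false` copy determines all identifiers, and the bits are read from the `true` copy, which
  -- is still fresh.
  refine mul_measure_le_of_le_condProb (A := {p | p.2 = false}) (hκ.measurable mgood) _
    fun x hx => ?_
  -- Identifiers that are injective on `W` extend to a bijection on the whole tree; outside `W` the
  -- algorithm's behavior is irrelevant to `good`.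
  obtain ⟨e, he⟩ := Set.MapsTo.exists_equiv_extend_of_card_eq (α := treeNodes I) (β := Fin n)
    (t := Finset.univ) (by simp [hcard]) (s := {u | u.1 ∈ W}) (f := fun u => (x (u.1, false)).1)
    (fun _ _ => by simp) (fun u hu v hv huv => Subtype.ext (hx hu hv huv))
  let ids : treeNodes I ≃ Fin n := e.trans (Equiv.subtypeUnivEquiv fun _ => Finset.mem_univ _)
  have hids : ∀ u : treeNodes I, u.1 ∈ W → (x (u.1, false)).1 = ids u := fun u hu => (he u hu).symm
  refine (hA ids).trans ?_
  rw [← (measurePreserving_bits (n := n) (treeNodes I)).measure_preimage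
    (A.measurableSet_isWeakColoring_run _ ids).nullMeasurableSet]
  refine measure_mono fun y hy => ?_
  simp only [Set.mem_preimage, Set.mem_ofPred_eq, hgood, Set.mem_iInter, Set.mem_compl_iff]
  intro i _
  have hci : c i ∈ treeNodes I := mem_treeNodes.2 (Or.inl (hcI i (by simp [treeBall])))
  refine A.shift_notMem_nodeFailure hI ids (v := ⟨c i, hci⟩) (hcI i) (fun u hu => ?_)
    (fun u => ?_) hy
  · rw [← hids u (hcW i hu)]
    simp [κ]
  · simp [κ]

/-- Bernoulli's inequality for `(1 + q) ^ m` together with `(1 - q) * (1 + q) ≤ 1`. Combined with `1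
/ 4 ≤ (1 - q) ^ m` it gives `m * q ≤ 3`. -/
lemma one_sub_pow_mul_le_one {q : ℝ} (h0 : 0 ≤ q) (h1 : q ≤ 1) (m : ℕ) :
    (1 - q) ^ m * (1 + m * q) ≤ 1 := by
  calc (1 - q) ^ m * (1 + m * q) ≤ (1 - q) ^ m * (1 + q) ^ m := by
        gcongr
        exact one_add_mul_le_pow (by linarith) m
    _ = (1 - q ^ 2) ^ m := by rw [← mul_pow]; ring
    _ ≤ 1 := pow_le_one₀ (by nlinarith) (by nlinarith)

/-- An algorithm with global success probability one half rarely fails at a given node of the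
infinite tree with random identifiers. -/
lemma measure_nodeFailure_infiniteRule_le {A : LocalAlgorithm n t 2} {k m : ℕ} (hn : n = 3 * k + 2)
    (hA : ∀ (V : Type) [Fintype V] (G : OrientedTree V) (ids : V ≃ Fin n),
      1 / 2 ≤ bitsLaw V {ω | IsWeakColoring G.graph (A.run G ids ω)})
    (hk : 5 ^ ((2 * t + 3) * m + t + 1) ≤ k) (hm : 2 * (m * 5 ^ (t + 1)) ^ 2 ≤ n) :
    m * (iidLaw (FreeGroup Bool) (nodeLabelLaw n)).real (nodeFailure A.infiniteRule) ≤ 3 := by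
  classical
  obtain ⟨I, hI, hball, hcard⟩ := exists_isPrefixClosed hk
  let c : Fin m → FreeGroup Bool := fun i => lineCenter (t + 1) i
  have hsub : ∀ i, treeBall (c i) (t + 1) ⊆ ballFinset ((2 * t + 3) * m + t + 1) := fun i => by
    refine treeBall_lineCenter_subset ?_
    have := i.2
    nlinarith
  -- Distinctness of identifiers is required only on the union of the balls, whose size is small
  -- compared with `n`.
  let W : Finset (FreeGroup Bool) :=
    Finset.univ.biUnion fun i : Fin m => (ballFinset (t + 1)).image fun h => c i * h
  have hWcard : W.card ≤ m * 5 ^ (t + 1) := by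
    refine (Finset.card_biUnion_le_card_mul _ _ (5 ^ (t + 1)) fun i _ =>
      Finset.card_image_le.trans (card_ballFinset_le _)).trans ?_
    simp
  have hq := quarter_le_measure_iInter (A := A) hI (by rw [hI.card_treeNodes, hcard, hn])
    (fun ids => hA _ hI.orientedTree ids) (W := W) (c := c)
    (le_trans (by gcongr) hm)
    (fun i => (hsub i).trans (by exact_mod_cast hball)) fun i h hh => by
      refine Finset.mem_biUnion.2 ⟨i, Finset.mem_univ _, Finset.mem_image.2 ⟨(c i)⁻¹ * h, ?_, by simp⟩⟩
      exact mem_ballFinset.2 hh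
  have hmf := measurableSet_nodeFailure A.measurableSet_infiniteRule_eq
  have hdep : DependsOn (· ∈ (nodeFailure A.infiniteRule)ᶜ) (treeBall 1 (t + 1)) := by
    intro ω ω' h
    have h0 : A.infiniteRule ω = A.infiniteRule ω' :=
      A.dependsOn_infiniteRule fun i hi => h i (treeBall_mono t.le_succ hi)
    have h1 : ∀ x : Dir, A.infiniteRule (shift x.gen ω) = A.infiniteRule (shift x.gen ω') := fun x =>
      A.dependsOn_infiniteRule.comp_shift x.gen
        (fun k hk => treeBall_gen_subset (gen_mul_mem_treeBall.2 hk)) h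
    simp [nodeFailure, h0, h1]
  rw [measure_biInter_of_dependsOn_disjoint (A := fun i => treeBall (c i) (t + 1)) Finset.univ
    (fun i => measurable_shift _ hmf.compl)
    (fun i => hdep.comp_shift (c i) fun k hk => by
      rw [← mul_one (c i), mul_assoc, mul_mem_treeBall, one_mul]
      exact hk)
    (fun i j hij => disjoint_treeBall_lineCenter fun h => hij (Fin.ext h))] at hq
  simp_rw [(measurePreserving_shift (nodeLabelLaw n) _).measure_preimage
    hmf.compl.nullMeasurableSet] at hq
  rw [Finset.prod_const, Finset.card_univ, Fintype.card_fin] at hq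
  have hreal : (1 / 4 : ℝ) ≤
      (1 - (iidLaw (FreeGroup Bool) (nodeLabelLaw n)).real (nodeFailure A.infiniteRule)) ^ m := by
    rw [← probReal_compl_eq_one_sub hmf, measureReal_def, ← ENNReal.toReal_pow]
    have := ENNReal.toReal_mono (ENNReal.pow_ne_top (measure_ne_top _ _)) hq
    refine le_trans ?_ this
    norm_num
  have hb := one_sub_pow_mul_le_one (measureReal_nonneg (μ := iidLaw (FreeGroup Bool)
    (nodeLabelLaw n)) (s := nodeFailure A.infiniteRule)) measureReal_le_one m
  set q := (iidLaw (FreeGroup Bool) (nodeLabelLaw n)).real (nodeFailure A.infiniteRule)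
  have hq0 : 0 ≤ (m : ℝ) * q := mul_nonneg (Nat.cast_nonneg _) measureReal_nonneg
  nlinarith

end Simulation

/-! ### The lower bound. -/

lemma not_weakColoringSolvable {n t : ℕ} (hn3 : n % 3 = 2) (h : twoTower (2 * t + 7) < n) :
    ¬ WeakColoringSolvable 2 n t (1 / 2) := by
  rintro ⟨A, hA⟩
  have : NeZero n := ⟨by omega⟩
  have h5 := five_pow_lt_of_twoTower_lt h
  set m := sampleSize t with hm
  have hm1 : 1 ≤ m := by
    have : 0 < (4 * nodePalette^[t] 2 + 1) ^ failureExponent t := by positivity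
    rw [hm, sampleSize]
    omega
  have hle := measure_nodeFailure_infiniteRule_le (A := A) (k := n / 3) (m := m) (by omega) hA
    (by
      -- The spare factor `5 ^ 3` covers the passage from `n` to the number `n / 3` of interior
      -- nodes.
      rw [show (2 * t + 3) * m + t + 4 = (2 * t + 3) * m + t + 1 + 3 by ring, pow_add] at h5
      omega)
    (by
      refine le_trans ?_ h5.le
      have hmm : m ≤ 2 ^ m := m.lt_two_pow_self.le
      calc 2 * (m * 5 ^ (t + 1)) ^ 2 = 2 * (m ^ 2 * 5 ^ (2 * t + 2)) := by ring
        _ ≤ 5 * ((2 ^ m) ^ 2 * 5 ^ (2 * t + 2)) := by gcongr; norm_num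
        _ = 5 * (4 ^ m * 5 ^ (2 * t + 2)) := by rw [← pow_mul, mul_comm m 2, pow_mul]; norm_num
        _ ≤ 5 * (5 ^ m * 5 ^ (2 * t + 2)) := by gcongr; norm_num
        _ = 5 ^ (m + 2 * t + 3) := by ring
        _ ≤ _ := Nat.pow_le_pow_right (by norm_num) (by nlinarith))
  have hlow := inv_pow_lt_measure_nodeFailure (ν := nodeLabelLaw n) t
    A.measurableSet_infiniteRule_eq A.dependsOn_infiniteRule
    (D := 4 * nodePalette^[t] 2 + 1) (by simp)
  have hlow' := (ENNReal.toReal_lt_toReal (ENNReal.pow_ne_top (by simp)) (measure_ne_top _ _)).2 hlow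
  rw [ENNReal.toReal_pow, ENNReal.toReal_inv, ENNReal.toReal_natCast, inv_pow,
    ← measureReal_def] at hlow'
  have hmr : (m : ℝ) = 3 * ((4 * nodePalette^[t] 2 + 1 : ℕ) : ℝ) ^ failureExponent t := by
    rw [hm, sampleSize]
    push_cast
    ring
  have hpos : (0 : ℝ) < ((4 * nodePalette^[t] 2 + 1 : ℕ) : ℝ) ^ failureExponent t := by positivity
  rw [hmr] at hle
  rw [inv_lt_iff_one_lt_mul₀ hpos] at hlow'
  -- With `P = D ^ failureExponent t` and failure probability `q`, the bounds read `3 * P * q ≤ 3`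
  -- and `1 < P * q`, up to the order of factors.
  nlinarith

theorem theorem5 :
    (∃ c : ℝ, 0 < c ∧ ∃ n₀ : ℕ, ∀ n : ℕ, n₀ ≤ n → n % 3 = 2 →
      ∀ t : ℕ, WeakColoringSolvable 2 n t (1 / 2) → c * (logStar n : ℝ) ≤ (t : ℝ)) ∧
    (∃ n₀ : ℕ, ∀ n : ℕ, n₀ ≤ n → n % 3 = 2 →
      ∀ t : ℕ, (t : ℝ) ≤ (1 / 2 : ℝ) * (logStar n : ℝ) - 4 →
        ¬ WeakColoringSolvable 2 n t (1 / 2)) := by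
  have main : ∀ n : ℕ, n % 3 = 2 → ∀ t : ℕ, (t : ℝ) ≤ (1 / 2 : ℝ) * (logStar n : ℝ) - 4 →
      ¬ WeakColoringSolvable 2 n t (1 / 2) := by
    intro n hn t ht
    refine not_weakColoringSolvable hn (twoTower_lt_of_lt_logStar ?_)
    have : ((2 * t + 8 : ℕ) : ℝ) ≤ logStar n := by
      push_cast
      linarith
    have : 2 * t + 8 ≤ logStar n := by exact_mod_cast this
    omega
  -- The threshold `16` is where `logStar n / 4` drops below `logStar n / 2 - 4`. The concrete bound
  -- needs no threshold: its hypothesis on `t` already forces `n` to be large.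
  obtain ⟨n₀, hn₀⟩ := exists_forall_lt_logStar 16
  refine ⟨⟨1 / 4, by norm_num, n₀, fun n hn hn3 t hs => ?_⟩, 0, fun n _ => main n⟩
  by_contra! hc
  refine main n hn3 t ?_ hs
  have : (16 : ℝ) < logStar n := by exact_mod_cast hn₀ n hn
  linarith
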